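/- **Setting.** Let $d\ge 1$ and $m$ be integers and let $0\le\alpha\le 2$, $\beta\ge 0$, $A>0$, $a_0>0$, $M$, $M'$, $C_0$, $\mu$ be real numbers. For $x\in\mathbb R^d$, $a>0$ let $B(x,a)$ be the axis-parallel closed cube with center $x$ and side length $a$, and for $E\subset\mathbb R^d$ let $\mathcal P(E,a)$ be the largest number of cubes of side length $a$ centered in $E$ with pairwise disjoint interiors. Let $S\subset\mathbb R^d$ be compact, $D=\bigcup_{x\in S}B(x,A)$, let $f:D\to\mathbb R$ be measurable, and let $x^*\in S$ with $f(x)\ge f(x^*)$ for all $x\in D$. Assume: (a) $f(x)-f(x^*)\le M$ for all $x\in S$; (b) for all $0<a<A$ and $x\in S$, $f$ is integrable on $B(x,a)$ and $\left|a^{-d}\int_{B(x,a)}f(u)\,du-f(x)\right|\le Ma^\alpha$; (c) $\mathcal P(\{x\in D: f(x)-f(x^*)<\epsilon\},a)\le C_0(1+\epsilon^\beta/a^d)$ for all $a,\epsilon>0$. **Algorithm.** Let $B_1,\dots,B_m\subset D$ be axis-parallel cubes (bins) of side length $a_0$ covering $S$, such that $f-f(x^*)\le M'$ on $\bigcup_j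 B_j$. (If the bins subdivide $S$ exactly, this is (a) with $M'=M$.) Each bin $B$ carries a split count $k(B)$, a set $I(B)$ of rounds recorded in it, and $n(B)=|I(B)|$; initially the current bins are $B_1,\dots,B_m$, with $k=0$ and $I=\emptyset$. The lower confidence bounds are $$g_{t+1}(B)=\frac1{n(B)}\sum_{i\in I(B)}Y_i-\mu\,(a_02^{-k(B)})^\alpha-n(B)^{-1/2}\ln t\quad\text{if } n(B)>0,\qquad g_{t+1}(B)=-\infty\quad\text{if } n(B)=0,$$ where $I(B)$ and $n(B)$ are taken after round $t$. In round $t=1,2,\dots$ a current bin $B$ with the smallest $g_t(B)$ is picked (ties are broken by an arbitrary, possibly randomized, rule based on the past), $X_t$ is drawn uniformly from $B$, and $Y_t=f(X_t)+W_t$ is received, where $W_t\sim\mathcal N(0,1)$ is independent of $X_t$ and of the past. If $n(B)<\lceil 2^{2\alpha k(B)}\rceil$ before the query, then $t$ is added to $I(B)$. Otherwise $B$ is replaced by its $2^d$ sub-cubes of half the side length, each with split count $k(B)+1$ and empty $I$, and $t$ is added to $I$ of the sub-cube that contains $X_t$. **Theorem.** If $\mu>(1+2^{d+\alpha})M$,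 then there is a constant $C$, depending only on $d,m,\alpha,\beta,A,M,M',C_0,a_0,\mu$, such that for all $S,f,x^*$ and initial bins as above, and for all $T\ge 2$, the expected cumulative regret $R=\mathbb E\left[\sum_{t=1}^T(f(X_t)-f(x^*))\right]$ is well defined and finite, and $$\frac RT\le C\,T^{-\frac{\alpha}{d+2\alpha-\alpha\beta}}\,(\ln T)^{\beta+1}.$$ -/

import Mathlib

open MeasureTheory ProbabilityTheory

noncomputable section

namespace AdaptiveBandit

/-! ### Cubes, packing numbers and the assumptions on the cost function

Points of `ℝ^d` are functions `Fin d → ℝ`, with Lebesgue measure `volume`. -/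

/-- The closed cube with center `x` and side length `a`. -/
def cube {d : ℕ} (x : Fin d → ℝ) (a : ℝ) : Set (Fin d → ℝ) :=
  Set.Icc (fun i => x i - a / 2) (fun i => x i + a / 2)

/-- The packing number of `E` with cubes of side length `a`: the largest number of cubes of side
length `a` centered at points of `E` whose interiors are pairwise disjoint. -/
def packingNumber {d : ℕ} (E : Set (Fin d → ℝ)) (a : ℝ) : ℕ∞ :=
  ⨆ (P : Finset (Fin d → ℝ))
    (_ : (P : Set (Fin d → ℝ)) ⊆ E ∧
      (P : Set (Fin d → ℝ)).PairwiseDisjoint (fun x => interior (cube x a))),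
    (P.card : ℕ∞)

/-- The domain of the cost function: all points of the cubes of side length `A` centered
in `S`. -/
def domain {d : ℕ} (S : Set (Fin d → ℝ)) (A : ℝ) : Set (Fin d → ℝ) :=
  ⋃ x ∈ S, cube x A

/-- `f` is a measurable cost function on `domain S A` with minimizer `xs ∈ S`, `S` compact, and it
has bounded gap on `S`, smoothness exponent `α` and sublevel-set packing exponent `β`. -/
structure CostAssumption {d : ℕ} (S : Set (Fin d → ℝ)) (A M C₀ α β : ℝ)
    (f : (Fin d → ℝ) → ℝ) (xs : Fin d → ℝ) : Prop where
  isCompact : IsCompact S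
  measurable : Measurable f
  minimizer_mem : xs ∈ S
  minimizer_le : ∀ x ∈ domain S A, f xs ≤ f x
  gap_le : ∀ x ∈ S, f x - f xs ≤ M
  integrableOn : ∀ a : ℝ, 0 < a → a < A → ∀ x ∈ S, IntegrableOn f (cube x a) volume
  smooth : ∀ a : ℝ, 0 < a → a < A → ∀ x ∈ S, |(⨍ u in cube x a, f u) - f x| ≤ M * a ^ α
  packing : ∀ a ε : ℝ, 0 < a → 0 < ε →
    (packingNumber {x | x ∈ domain S A ∧ f x - f xs < ε} a : ENNReal) ≤
      ENNReal.ofReal (C₀ * (1 + ε ^ β / a ^ d))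

/-! ### Bins -/

/-- A bin is given by the index of the initial bin that it comes from, and by the list of
the choices of a child that lead to it (the most recent one first). In each choice, `true` in
coordinate `i` stands for the upper half of the parent in the direction `i`. -/
abbrev Bin (d m : ℕ) : Type := Fin m × List (Fin d → Bool)

/-- The number of splits `k(B)` that a bin has experienced. -/
def Bin.level {d m : ℕ} (B : Bin d m) : ℕ := B.2.length

/-- The side length `a₀ 2^{-k(B)}` of a bin. -/
def Bin.side {d m : ℕ} (a₀ : ℝ) (B : Bin d m) : ℝ := a₀ / 2 ^ B.level

/-- The lower corner of the cube reached from an initial cube with lower corner `c₀` and side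
length `a₀` through a list of choices of children. -/
def cornerAux {d : ℕ} (a₀ : ℝ) (c₀ : Fin d → ℝ) : List (Fin d → Bool) → (Fin d → ℝ)
  | [] => c₀
  | l :: p => fun i => cornerAux a₀ c₀ p i + (if l i then a₀ / 2 ^ (p.length + 1) else 0)

/-- The lower corner of a bin, where `c j` is the lower corner of the initial bin `j`. -/
def Bin.corner {d m : ℕ} (a₀ : ℝ) (c : Fin m → Fin d → ℝ) (B : Bin d m) : Fin d → ℝ :=
  cornerAux a₀ (c B.1) B.2

/-- The cube that a bin occupies. -/
def Bin.region {d m : ℕ} (a₀ : ℝ) (c : Fin m → Fin d → ℝ) (B : Bin d m) : Set (Fin d → ℝ) :=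
  Set.Icc (B.corner a₀ c) (fun i => B.corner a₀ c i + B.side a₀)

/-- The child of `B` with label `l`. -/
def Bin.child {d m : ℕ} (B : Bin d m) (l : Fin d → Bool) : Bin d m := (B.1, l :: B.2)

/-- The `2^d` children of `B`. -/
def Bin.children {d m : ℕ} (B : Bin d m) : Finset (Bin d m) := Finset.univ.image B.child

/-- The child of `B` that contains the point `x` of `B`; a point on a common face of several
children goes to the upper one. -/
def Bin.childAt {d m : ℕ} (a₀ : ℝ) (c : Fin m → Fin d → ℝ) (B : Bin d m) (x : Fin d → ℝ) :
    Bin d m :=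
  B.child (fun i => decide (B.corner a₀ c i + B.side a₀ / 2 ≤ x i))

/-- The capacity `⌈2^{2αk(B)}⌉` of a bin. -/
def Bin.capacity {d m : ℕ} (α : ℝ) (B : Bin d m) : ℕ := ⌈(2 : ℝ) ^ (2 * α * (B.level : ℝ))⌉₊

/-- The initial bins (cubes with lower corners `c j` and side length `a₀`) cover `S`, and `f` is
defined on each of them. -/
structure InitialBins {d m : ℕ} (S : Set (Fin d → ℝ)) (A a₀ : ℝ) (c : Fin m → Fin d → ℝ) :
    Prop where
  cover : S ⊆ ⋃ j : Fin m, Bin.region a₀ c ((j, []) : Bin d m)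
  subset_domain : ∀ j : Fin m, Bin.region a₀ c ((j, []) : Bin d m) ⊆ domain S A

/-! ### The adaptive bin splitting algorithm -/

/-- The state of the algorithm: the current set of bins, and for each bin `B` the set
`I(B)` of the indices of the queries recorded in `B`; the number `n(B)` of these queries is
the cardinality of `I(B)`. -/
structure State (d m : ℕ) where
  bins : Finset (Bin d m)
  idx : Bin d m → Finset ℕ

/-- Initially the bins are the `m` initial bins, and there are no queries. -/
def State.init (d m : ℕ) : State d m where
  bins := Finset.univ.image (fun j : Fin m => ((j, []) : Bin d m))
  idx := fun _ => ∅

/-- The update in round `t`, in which the bin `B` is picked and the point `x` is queried. Below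
capacity, `t` is recorded in `B`. At capacity, `B` is replaced by its children, which start
without recorded queries, and `t` is recorded in the child that contains `x`. -/
def State.step {d m : ℕ} (α a₀ : ℝ) (c : Fin m → Fin d → ℝ) (s : State d m)
    (t : ℕ) (B : Bin d m) (x : Fin d → ℝ) : State d m :=
  if (s.idx B).card < B.capacity α then
    { bins := s.bins
      idx := Function.update s.idx B (insert t (s.idx B)) }
  else
    { bins := s.bins.erase B ∪ B.children
      idx := Function.update (fun B' => if B' ∈ B.children then ∅ else s.idx B')
        (B.childAt a₀ c x) {t} }

/-- The lower confidence bound `g_{t+1}(B)`, computed after round `t` from the state `s` and the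
responses `y 1, …, y t`. -/
def State.lcb {d m : ℕ} (α a₀ μ : ℝ) (s : State d m) (y : ℕ → ℝ) (t : ℕ) (B : Bin d m) : EReal :=
  if s.idx B = ∅ then ⊥
  else
    (((1 / ((s.idx B).card : ℝ)) * (∑ i ∈ s.idx B, y i) - μ * (B.side a₀) ^ α
      - ((s.idx B).card : ℝ) ^ (-(1 / 2) : ℝ) * Real.log t : ℝ) : EReal)

/-- The state after `t` rounds, if in round `r = 1, 2, …` the bin `b r` is picked and the
point `x r` is queried. -/
def stateAfter {d m : ℕ} (α a₀ : ℝ) (c : Fin m → Fin d → ℝ)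
    (b : ℕ → Bin d m) (x : ℕ → Fin d → ℝ) : ℕ → State d m
  | 0 => State.init d m
  | t + 1 => (stateAfter α a₀ c b x t).step α a₀ c (t + 1) (b (t + 1)) (x (t + 1))

/-- A run of the algorithm on the cost function `f`, on a probability space `(Ω, P)`. In
round `t + 1 = 1, 2, …` the picked bin is `b (t + 1)`, the query is `X (t + 1)`, the noise
is `W (t + 1)` and the response is `Y (t + 1)`; the values at index `0` play no role.
The `σ`-algebra `ℱ t` holds what is known when the bin of round `t + 1` has been picked: the
first `t` rounds and any randomness used for breaking ties, so that every rule for breaking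
ties, random or not, is covered. -/
structure IsRun {d m : ℕ} (α a₀ μ : ℝ) (c : Fin m → Fin d → ℝ) (f : (Fin d → ℝ) → ℝ)
    {Ω : Type*} [mΩ : MeasurableSpace Ω] (P : Measure Ω) (ℱ : Filtration ℕ mΩ)
    (b : ℕ → Ω → Bin d m) (U : ℕ → Ω → Fin d → ℝ) (X : ℕ → Ω → Fin d → ℝ)
    (W Y : ℕ → Ω → ℝ) : Prop where
  /-- the picked bin is a current bin with the lowest lower confidence bound -/
  pick_mem : ∀ t ω, b (t + 1) ω ∈
    (stateAfter α a₀ c (fun r => b r ω) (fun r => X r ω) t).bins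
  pick_min : ∀ t ω, ∀ B ∈ (stateAfter α a₀ c (fun r => b r ω) (fun r => X r ω) t).bins,
    (stateAfter α a₀ c (fun r => b r ω) (fun r => X r ω) t).lcb α a₀ μ
        (fun r => Y r ω) t (b (t + 1) ω) ≤
      (stateAfter α a₀ c (fun r => b r ω) (fun r => X r ω) t).lcb α a₀ μ
        (fun r => Y r ω) t B
  pick_measurable : ∀ t B, MeasurableSet[ℱ t] {ω | b (t + 1) ω = B}
  /-- the query is uniformly distributed in the picked bin -/
  query_eq : ∀ t ω i, X (t + 1) ω i =
    (b (t + 1) ω).corner a₀ c i + (b (t + 1) ω).side a₀ * U (t + 1) ω i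
  unif_measurable : ∀ t, Measurable[ℱ (t + 1)] (U (t + 1))
  unif_law : ∀ t, P.map (U (t + 1)) =
    (volume : Measure (Fin d → ℝ)).restrict (Set.Icc 0 1)
  /-- the response is the cost at the query with additive standard Gaussian noise -/
  response_eq : ∀ t ω, Y (t + 1) ω = f (X (t + 1) ω) + W (t + 1) ω
  noise_measurable : ∀ t, Measurable[ℱ (t + 1)] (W (t + 1))
  noise_law : ∀ t, P.map (W (t + 1)) = gaussianReal 0 1
  /-- fresh noise and fresh uniform variables, independent of each other and of the past -/
  unif_indep_noise : ∀ t, IndepFun (U (t + 1)) (W (t + 1)) P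
  indep_past : ∀ t, Indep
    (MeasurableSpace.comap (fun ω => (U (t + 1) ω, W (t + 1) ω)) inferInstance) (ℱ t) P

/-- The cumulative regret of the queries `x 1, …, x T` for the cost function `f` with
minimizer `xs`. -/
def cumRegret {d : ℕ} (f : (Fin d → ℝ) → ℝ) (xs : Fin d → ℝ) (x : ℕ → Fin d → ℝ) (T : ℕ) : ℝ :=
  ∑ t ∈ Finset.Icc 1 T, (f (x t) - f xs)

end AdaptiveBandit

end

namespace AdaptiveBandit

/-! ### Geometry of the bins -/

section Geometry

variable {d m : ℕ} {a₀ : ℝ} {c : Fin m → Fin d → ℝ}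

/-! Given the picked bin, the query is uniform in it. So the expected regret is the expected sum of
the gaps of the picked bins, where the gap is the mean of f - f(x^*) over a bin
(`IsRun.integral_gap_query`).

A query recorded in a bin is uniform in that bin, even if it was made in the parent at the moment of
the split. The centered responses recorded in a bin are therefore conditionally sub-Gaussian. An
exponential supermartingale argument and a union bound over all bins show that, outside an event of
probability O(t^{-3}), every mean of n recorded responses is within n^{-1/2} ln t / 2 of the mean
cost of its bin (`IsRun.measure_deviationEvent_le`).

Outside this event, a current bin that contains x^* has a lower confidence bound of at most f(x^*):
by smoothness its gap is at most 2^{d+α} M times its side to the power α, which the term with μ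
absorbs. If the bin is too large for the smoothness assumption, the logarithmic term suffices once t
is large. A bin that is split at level k has the smallest bound and at least 2^{2αk} records, so its
gap is O(2^{-αk} ln T) (`exists_gap_le_of_split`).

Each current bin is an initial bin or a child of a split bin, and in the second case its gap is at
most 2^d times that of the parent (`GapBounds.gap_child_le`). By the packing assumption, O(1 + (ln
T)^β 2^{(d-αβ)k}) bins of level k have a gap of order 2^{-αk} ln T (`CostAssumption.card_bins_le`),
and the children of each are picked O(2^{2αk}) times. Hence level k costs O((ln T)^{β+1}
2^{(d+α-αβ)k}), and all levels from K on cost O(T 2^{-αK} ln T). The choice 2^{(d+2α-αβ)K} ≈ T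
balances the two. The sum over k is geometric because the assumptions force αβ ≤ d
(`CostAssumption.mul_le`).

A deviation after round s affects only the children of one bin, whose capacity is at most s when it
is split. It spoils O(s) rounds, and the sum of s · s^{-3} converges. -/

@[simp] lemma Bin.level_child (B : Bin d m) (l : Fin d → Bool) :
    (B.child l).level = B.level + 1 := rfl

@[simp] lemma Bin.side_child (B : Bin d m) (l : Fin d → Bool) :
    (B.child l).side a₀ = B.side a₀ / 2 := by
  simp [Bin.side, pow_succ, div_div]

lemma Bin.side_pos (ha₀ : 0 < a₀) (B : Bin d m) : 0 < B.side a₀ := by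
  unfold Bin.side; positivity

lemma Bin.corner_child (B : Bin d m) (l : Fin d → Bool) (i : Fin d) :
    (B.child l).corner a₀ c i = B.corner a₀ c i + (if l i then B.side a₀ / 2 else 0) := by
  simp only [Bin.corner, Bin.child, cornerAux, Bin.side, Bin.level, pow_succ, div_div]

lemma Bin.mem_region {B : Bin d m} {x : Fin d → ℝ} :
    x ∈ B.region a₀ c ↔ ∀ i, B.corner a₀ c i ≤ x i ∧ x i ≤ B.corner a₀ c i + B.side a₀ := by
  simp [Bin.region, Set.mem_Icc, Pi.le_def, forall_and]

lemma Bin.region_child_subset (ha₀ : 0 < a₀) (B : Bin d m) (l : Fin d → Bool) :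
    (B.child l).region a₀ c ⊆ B.region a₀ c := by
  intro x hx
  rw [Bin.mem_region] at hx ⊢
  intro i
  have h := hx i
  rw [Bin.corner_child, Bin.side_child] at h
  have hs := B.side_pos ha₀
  split_ifs at h <;> constructor <;> linarith [h.1, h.2]

lemma Bin.region_subset_root (ha₀ : 0 < a₀) (B : Bin d m) :
    B.region a₀ c ⊆ Bin.region a₀ c ((B.1, []) : Bin d m) := by
  obtain ⟨j, p⟩ := B
  induction p with
  | nil => exact subset_rfl
  | cons l p ih => exact (Bin.region_child_subset ha₀ ((j, p) : Bin d m) l).trans ih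

lemma Bin.mem_region_childAt {B : Bin d m} {x : Fin d → ℝ} (hx : x ∈ B.region a₀ c) :
    x ∈ (B.childAt a₀ c x).region a₀ c := by
  rw [Bin.mem_region] at hx ⊢
  intro i
  have h := hx i
  rw [Bin.childAt, Bin.corner_child, Bin.side_child]
  by_cases hi : B.corner a₀ c i + B.side a₀ / 2 ≤ x i
  · rw [if_pos (decide_eq_true hi)]
    constructor <;> linarith [h.2]
  · rw [if_neg (by simpa using hi)]
    constructor <;> linarith [h.1]

lemma Bin.child_injective (B : Bin d m) : Function.Injective B.child := by
  intro l l' h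
  simpa [Bin.child] using h

lemma Bin.mem_children {B B' : Bin d m} : B' ∈ B.children ↔ ∃ l, B.child l = B' := by
  simp [Bin.children]

lemma Bin.childAt_mem_children (B : Bin d m) (x : Fin d → ℝ) :
    B.childAt a₀ c x ∈ B.children := Bin.mem_children.2 ⟨_, rfl⟩

lemma Bin.one_le_capacity (α : ℝ) (B : Bin d m) : 1 ≤ B.capacity α :=
  Nat.one_le_iff_ne_zero.2 (Nat.ceil_pos.2 (by positivity)).ne'

/-- Induction on the most recent choice. If the earlier choices differ, the parent corners are two
current side lengths apart in some coordinate, and the last choices remove at most one. If they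
agree, the last choices differ in some coordinate. -/
lemma cornerAux_separated (ha₀ : 0 < a₀) (c₀ : Fin d → ℝ) :
    ∀ (k : ℕ) (p q : List (Fin d → Bool)), p.length = k → q.length = k → p ≠ q →
      ∃ i, a₀ / 2 ^ k ≤ |cornerAux a₀ c₀ p i - cornerAux a₀ c₀ q i|
  | 0, p, q, hp, hq, hne => by
      rw [List.length_eq_zero_iff] at hp hq
      exact absurd (hp.trans hq.symm) hne
  | k + 1, [], _, hp, _, _ => by simp at hp
  | k + 1, _ :: _, [], _, hq, _ => by simp at hq
  | k + 1, l :: p, l' :: q, hp, hq, hne => by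
      have hp' : p.length = k := by simpa using hp
      have hq' : q.length = k := by simpa using hq
      have hpos : 0 < a₀ / 2 ^ (k + 1) := by positivity
      have h2 : a₀ / 2 ^ k = 2 * (a₀ / 2 ^ (k + 1)) := by rw [pow_succ]; field_simp
      by_cases hpq : p = q
      · subst hpq
        have hl : l ≠ l' := fun h => hne (by rw [h])
        obtain ⟨i, hi⟩ := Function.ne_iff.1 hl
        refine ⟨i, ?_⟩
        simp only [cornerAux, hp']
        rcases hli : l i <;> rcases hli' : l' i <;> simp_all [abs_of_pos]
      · obtain ⟨i, hi⟩ := cornerAux_separated ha₀ c₀ k p q hp' hq' hpq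
        refine ⟨i, ?_⟩
        simp only [cornerAux, hp', hq']
        rw [h2] at hi
        generalize a₀ / 2 ^ (k + 1) = s at *
        rcases le_abs.1 hi with h | h
        · refine le_trans ?_ (le_abs_self _)
          split_ifs <;> linarith
        · refine le_trans ?_ (neg_le_abs _)
          split_ifs <;> linarith

/-- Points of two different bins of the same level, with the same root and the same last choice
of a child, are at distance at least the side length in some coordinate. -/
lemma Bin.separated (ha₀ : 0 < a₀) {B B' : Bin d m} (hroot : B.1 = B'.1)
    (hlevel : B.level = B'.level) (hhead : B.2.head? = B'.2.head?) (hne : B ≠ B')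
    {x y : Fin d → ℝ} (hx : x ∈ B.region a₀ c) (hy : y ∈ B'.region a₀ c) :
    ∃ i, B.side a₀ ≤ |x i - y i| := by
  obtain ⟨j, p⟩ := B
  obtain ⟨j', q⟩ := B'
  obtain rfl : j = j' := hroot
  cases p with
  | nil =>
    cases q with
    | nil => exact absurd rfl hne
    | cons l' q => simp at hhead
  | cons l p =>
    cases q with
    | nil => simp at hhead
    | cons l' q =>
      obtain rfl : l = l' := by simpa using hhead
      have hpq : p ≠ q := fun h => hne (by rw [h])
      have hlen : q.length = p.length := by simpa [Bin.level] using hlevel.symm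
      -- Equal last choices shift both corners equally, so the corners are as far apart as those of
      -- the parents, which is two side lengths. Passing to points of the bins loses only one of
      -- them.
      obtain ⟨i, hi⟩ := cornerAux_separated ha₀ (c j) p.length p q rfl hlen hpq
      refine ⟨i, ?_⟩
      have hx' := Bin.mem_region.1 hx i
      have hy' := Bin.mem_region.1 hy i
      simp only [Bin.corner, cornerAux, Bin.side, Bin.level, List.length_cons, hlen]
        at hx' hy' ⊢
      have h2 : a₀ / 2 ^ p.length = 2 * (a₀ / 2 ^ (p.length + 1)) := by
        rw [pow_succ]; field_simp
      rw [h2] at hi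
      generalize a₀ / 2 ^ (p.length + 1) = s at *
      rcases le_abs.1 hi with h | h
      · refine le_trans ?_ (le_abs_self _)
        linarith [hx'.1, hy'.2]
      · refine le_trans ?_ (neg_le_abs _)
        linarith [hx'.2, hy'.1]

lemma disjoint_interior_cube {x y : Fin d → ℝ} {a : ℝ} (h : ∃ i, a ≤ |x i - y i|) :
    Disjoint (interior (cube x a)) (interior (cube y a)) := by
  obtain ⟨i, hi⟩ := h
  rw [Set.disjoint_left]
  intro z hzx hzy
  simp only [cube, ← Set.pi_univ_Icc] at hzx hzy
  rw [interior_pi_set Set.finite_univ] at hzx hzy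
  have h1 : z i ∈ interior (Set.Icc (x i - a / 2) (x i + a / 2)) := hzx i trivial
  have h2 : z i ∈ interior (Set.Icc (y i - a / 2) (y i + a / 2)) := hzy i trivial
  rw [interior_Icc] at h1 h2
  rcases le_abs.1 hi with h | h <;> linarith [h1.1, h1.2, h2.1, h2.2]

lemma self_mem_cube (x : Fin d → ℝ) {a : ℝ} (ha : 0 ≤ a) : x ∈ cube x a := by
  constructor <;> intro i <;> simp <;> linarith

lemma cube_subset_domain {S : Set (Fin d → ℝ)} {A a : ℝ} {x : Fin d → ℝ} (hx : x ∈ S)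
    (ha : a ≤ A) : cube x a ⊆ domain S A := by
  intro y hy
  refine Set.mem_iUnion₂.2 ⟨x, hx, ?_⟩
  refine Set.Icc_subset_Icc ?_ ?_ hy <;> intro i <;> simp <;> linarith

end Geometry

/-! ### The gap of a bin -/

section Gap

variable {d m : ℕ} {a₀ : ℝ} {c : Fin m → Fin d → ℝ}

/-- The uniform distribution on the unit cube. -/
noncomputable def unif (d : ℕ) : Measure (Fin d → ℝ) := volume.restrict (Set.Icc 0 1)

instance (d : ℕ) : IsProbabilityMeasure (unif d) := by
  constructor
  simp [unif, Real.volume_Icc_pi]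

lemma map_unif (p : Fin d → ℝ) {s : ℝ} (hs : 0 < s) :
    (unif d).map (fun u i => p i + s * u i) =
      ENNReal.ofReal ((s ^ d)⁻¹) • volume.restrict (Set.Icc p (fun i => p i + s)) := by
  have hg : Measurable (fun (u : Fin d → ℝ) i => p i + s * u i) := by fun_prop
  have hpre : (fun (u : Fin d → ℝ) i => p i + s * u i) ⁻¹' Set.Icc p (fun i => p i + s)
      = Set.Icc 0 1 := by
    ext u
    simp only [Set.mem_preimage, Set.mem_Icc, Pi.le_def, Pi.zero_apply, Pi.one_apply]
    refine and_congr (forall_congr' fun i => ?_) (forall_congr' fun i => ?_)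
    · rw [le_add_iff_nonneg_right]
      exact mul_nonneg_iff_of_pos_left hs
    · rw [add_le_add_iff_left]
      exact mul_le_iff_le_one_right hs
  have hvol : (volume : Measure (Fin d → ℝ)).map (fun u i => p i + s * u i) =
      ENNReal.ofReal ((s ^ d)⁻¹) • volume := by
    have h1 : (fun (u : Fin d → ℝ) i => p i + s * u i) = (fun x => p + x) ∘ (fun u => s • u) := by
      ext u i; simp
    rw [h1, ← Measure.map_map (by fun_prop) (by fun_prop),
      Measure.map_addHaar_smul _ hs.ne', Measure.map_smul, map_add_left_eq_self]
    simp [abs_of_pos hs]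
  rw [unif, ← hpre, ← Measure.restrict_map hg measurableSet_Icc, hvol, Measure.restrict_smul]

lemma setLIntegral_Icc_eq (p : Fin d → ℝ) {s : ℝ} (hs : 0 < s) {h : (Fin d → ℝ) → ENNReal}
    (hh : Measurable h) :
    ∫⁻ x in Set.Icc p (fun i => p i + s), h x =
      ENNReal.ofReal (s ^ d) * ∫⁻ u, h (fun i => p i + s * u i) ∂(unif d) := by
  have hg : Measurable (fun (u : Fin d → ℝ) i => p i + s * u i) := by fun_prop
  rw [← lintegral_map hh hg, map_unif p hs, lintegral_smul_measure, smul_eq_mul, ← mul_assoc,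
    ← ENNReal.ofReal_mul (by positivity), mul_inv_cancel₀ (by positivity)]
  simp

lemma setIntegral_Icc_eq (p : Fin d → ℝ) {s : ℝ} (hs : 0 < s) {h : (Fin d → ℝ) → ℝ}
    (hh : Measurable h) :
    ∫ x in Set.Icc p (fun i => p i + s), h x =
      s ^ d * ∫ u, h (fun i => p i + s * u i) ∂(unif d) := by
  have hg : Measurable (fun (u : Fin d → ℝ) i => p i + s * u i) := by fun_prop
  rw [← integral_map hg.aemeasurable hh.aestronglyMeasurable, map_unif p hs,
    integral_smul_measure, smul_eq_mul, ← mul_assoc,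
    ENNReal.toReal_ofReal (by positivity), mul_inv_cancel₀ (by positivity), one_mul]

/-- The point of a bin with relative coordinates `u`. -/
noncomputable def Bin.point (a₀ : ℝ) (c : Fin m → Fin d → ℝ) (B : Bin d m) (u : Fin d → ℝ) :
    Fin d → ℝ :=
  fun i => B.corner a₀ c i + B.side a₀ * u i

lemma Bin.measurable_point (B : Bin d m) : Measurable (B.point a₀ c) := by
  unfold Bin.point; fun_prop

lemma Bin.point_mem_region (ha₀ : 0 < a₀) (B : Bin d m) {u : Fin d → ℝ}
    (hu : u ∈ Set.Icc (0 : Fin d → ℝ) 1) : B.point a₀ c u ∈ B.region a₀ c := by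
  rw [Bin.mem_region]
  intro i
  have h0 : 0 ≤ u i := hu.1 i
  have h1 : u i ≤ 1 := hu.2 i
  have hs := B.side_pos ha₀
  simp only [Bin.point]
  constructor <;> nlinarith

/-- The cost function is measurable, and on the bins its gap lies between `0` and `M'`. -/
structure GapBounds (a₀ : ℝ) (c : Fin m → Fin d → ℝ) (f : (Fin d → ℝ) → ℝ)
    (xs : Fin d → ℝ) (M' : ℝ) : Prop where
  side_pos : 0 < a₀
  measurable : Measurable f
  le : ∀ (B : Bin d m), ∀ x ∈ B.region a₀ c, f xs ≤ f x
  sub_le : ∀ (B : Bin d m), ∀ x ∈ B.region a₀ c, f x - f xs ≤ M'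

/-- The mean gap between the cost in a bin and the minimal cost. -/
noncomputable def gap (a₀ : ℝ) (c : Fin m → Fin d → ℝ) (f : (Fin d → ℝ) → ℝ)
    (xs : Fin d → ℝ) (B : Bin d m) : ℝ :=
  ∫ u, (f (B.point a₀ c u) - f xs) ∂(unif d)

variable {f : (Fin d → ℝ) → ℝ} {xs : Fin d → ℝ} {M' : ℝ}

lemma ae_unif_mem : ∀ᵐ u ∂(unif d), u ∈ Set.Icc (0 : Fin d → ℝ) 1 :=
  ae_restrict_mem measurableSet_Icc

namespace GapBounds

lemma measurable_gap_point (hf : GapBounds a₀ c f xs M')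
    (B : Bin d m) : Measurable (fun u => f (B.point a₀ c u) - f xs) :=
  (hf.measurable.comp B.measurable_point).sub_const _

lemma ae_mem (hf : GapBounds a₀ c f xs M')
    (B : Bin d m) : ∀ᵐ u ∂(unif d), f (B.point a₀ c u) - f xs ∈ Set.Icc 0 M' := by
  filter_upwards [ae_unif_mem] with u hu
  have h := B.point_mem_region (c := c) hf.side_pos hu
  exact ⟨sub_nonneg.2 (hf.le B _ h), hf.sub_le B _ h⟩

lemma integrable (hf : GapBounds a₀ c f xs M')
    (B : Bin d m) : Integrable (fun u => f (B.point a₀ c u) - f xs) (unif d) :=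
  Integrable.of_mem_Icc 0 M' (hf.measurable_gap_point B).aemeasurable (hf.ae_mem B)

lemma gap_nonneg (hf : GapBounds a₀ c f xs M') (B : Bin d m) : 0 ≤ gap a₀ c f xs B :=
  integral_nonneg_of_ae ((hf.ae_mem B).mono fun _ h => h.1)

lemma gap_le (hf : GapBounds a₀ c f xs M') (B : Bin d m) : gap a₀ c f xs B ≤ M' := by
  have h := integral_mono_ae (hf.integrable B) (integrable_const M')
    ((hf.ae_mem B).mono fun _ h => h.2)
  simpa [gap] using h

lemma setIntegral_region (hf : GapBounds a₀ c f xs M') (B : Bin d m) :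
    ∫ x in B.region a₀ c, (f x - f xs) = B.side a₀ ^ d * gap a₀ c f xs B :=
  setIntegral_Icc_eq (B.corner a₀ c) (B.side_pos hf.side_pos) (hf.measurable.sub_const _)

lemma integrableOn_region (hf : GapBounds a₀ c f xs M') (B : Bin d m) :
    IntegrableOn (fun x => f x - f xs) (B.region a₀ c) := by
  have hfin : IsFiniteMeasure (volume.restrict (B.region a₀ c)) :=
    ⟨by rw [Measure.restrict_apply_univ]; exact isCompact_Icc.measure_lt_top⟩
  refine Integrable.of_mem_Icc 0 M' (hf.measurable.sub_const _).aemeasurable ?_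
  filter_upwards [ae_restrict_mem measurableSet_Icc] with x hx
  exact ⟨sub_nonneg.2 (hf.le B _ hx), hf.sub_le B _ hx⟩

/-- The integral of f - f(x^*) over the child is at most that over the parent, because the integrand
is nonnegative, and the child has 2^{-d} of the volume. This transfers the bound for a split bin to
its children, about which nothing is known yet. -/
lemma gap_child_le (hf : GapBounds a₀ c f xs M') (B : Bin d m) (l : Fin d → Bool) :
    gap a₀ c f xs (B.child l) ≤ 2 ^ d * gap a₀ c f xs B := by
  have h : ∫ x in (B.child l).region a₀ c, (f x - f xs) ≤
      ∫ x in B.region a₀ c, (f x - f xs) := by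
    refine setIntegral_mono_set (hf.integrableOn_region B) ?_
      (Bin.region_child_subset hf.side_pos B l).eventuallyLE
    filter_upwards [ae_restrict_mem measurableSet_Icc] with x hx
    exact sub_nonneg.2 (hf.le B _ hx)
  rw [hf.setIntegral_region, hf.setIntegral_region, Bin.side_child, div_pow] at h
  have hs : 0 < B.side a₀ ^ d := pow_pos (B.side_pos hf.side_pos) d
  have h2 : (0 : ℝ) < 2 ^ d := by positivity
  rw [div_mul_eq_mul_div, div_le_iff₀ h2, mul_assoc] at h
  have := le_of_mul_le_mul_left h hs
  linarith

lemma exists_le_gap (hf : GapBounds a₀ c f xs M')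
    (B : Bin d m) : ∃ x ∈ B.region a₀ c, f x - f xs ≤ gap a₀ c f xs B := by
  have hv : (volume : Measure (Fin d → ℝ)) (Set.Icc 0 1) = 1 := by
    simp [Real.volume_Icc_pi]
  obtain ⟨u, hu, hle⟩ := exists_le_setAverage (μ := volume) (s := Set.Icc (0 : Fin d → ℝ) 1)
    (f := fun u => f (B.point a₀ c u) - f xs) (by simp [hv]) (by simp [hv]) (hf.integrable B)
  refine ⟨_, B.point_mem_region hf.side_pos hu, ?_⟩
  rw [setAverage_eq] at hle
  simpa [Measure.real, hv, gap, unif] using hle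

end GapBounds

lemma volume_cube (x : Fin d → ℝ) {a : ℝ} (ha : 0 ≤ a) :
    (volume : Measure (Fin d → ℝ)) (cube x a) = ENNReal.ofReal (a ^ d) := by
  rw [cube, Real.volume_Icc_pi]
  have : ∀ i, x i + a / 2 - (x i - a / 2) = a := fun i => by ring
  simp [this, ENNReal.ofReal_pow ha]

/-! ### Consequences of smoothness at the minimizer and of the packing bound -/

section Assumption

variable {S : Set (Fin d → ℝ)} {A M C₀ α β : ℝ}

lemma CostAssumption.integral_cube_le (hS : CostAssumption S A M C₀ α β f xs) {a : ℝ}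
    (ha : 0 < a) (haA : a < A) : ∫ x in cube xs a, (f x - f xs) ≤ a ^ d * (M * a ^ α) := by
  have hv := volume_cube xs ha.le
  have hreal : (volume : Measure (Fin d → ℝ)).real (cube xs a) = a ^ d := by
    rw [Measure.real, hv, ENNReal.toReal_ofReal (by positivity)]
  have hsm := (abs_le.1 (hS.smooth a ha haA xs hS.minimizer_mem)).2
  rw [setAverage_eq, hreal, smul_eq_mul] at hsm
  have hpos : 0 < a ^ d := by positivity
  have hc : IntegrableOn (fun _ => f xs) (cube xs a) volume :=
    integrableOn_const (by simp [hv])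
  rw [integral_sub (hS.integrableOn a ha haA xs hS.minimizer_mem) hc]
  simp only [integral_const, smul_eq_mul, measureReal_restrict_apply_univ, hreal]
  have h := mul_le_mul_of_nonneg_left hsm hpos.le
  rw [mul_sub, mul_inv_cancel_left₀ hpos.ne'] at h
  exact h

/-- The bin lies in the cube of twice its side length around x^*. The larger cube costs a factor 2^d
in the volume and 2^α in the smoothness bound. -/
lemma CostAssumption.gap_le_of_mem (hS : CostAssumption S A M C₀ α β f xs)
    (hf : GapBounds a₀ c f xs M') {B : Bin d m} (hB : xs ∈ B.region a₀ c)
    (hA : 2 * B.side a₀ < A) :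
    gap a₀ c f xs B ≤ (2 : ℝ) ^ ((d : ℝ) + α) * M * B.side a₀ ^ α := by
  have hs := B.side_pos hf.side_pos
  have h := hS.integral_cube_le (mul_pos two_pos hs) hA
  have hsub : B.region a₀ c ⊆ cube xs (2 * B.side a₀) := by
    intro x hx
    rw [Bin.mem_region] at hx hB
    constructor <;> intro i <;> have h1 := hx i <;> have h2 := hB i <;> simp only <;>
      linarith [h1.1, h1.2, h2.1, h2.2]
  have hint : IntegrableOn (fun x => f x - f xs) (cube xs (2 * B.side a₀)) :=
    (hS.integrableOn _ (mul_pos two_pos hs) hA xs hS.minimizer_mem).sub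
      (integrableOn_const (by simp [volume_cube xs (mul_pos two_pos hs).le]))
  have h' : ∫ x in B.region a₀ c, (f x - f xs) ≤ ∫ x in cube xs (2 * B.side a₀), (f x - f xs) := by
    refine setIntegral_mono_set hint ?_ hsub.eventuallyLE
    filter_upwards [ae_restrict_mem measurableSet_Icc] with x hx
    exact sub_nonneg.2 (hS.minimizer_le x (cube_subset_domain hS.minimizer_mem hA.le hx))
  rw [hf.setIntegral_region] at h'
  have hpos : 0 < B.side a₀ ^ d := by positivity
  have h3 := h'.trans h
  rw [mul_pow, mul_comm (2 ^ d : ℝ), mul_assoc] at h3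
  have h4 := le_of_mul_le_mul_left h3 hpos
  rw [Real.mul_rpow two_pos.le hs.le] at h4
  rw [Real.rpow_add two_pos, Real.rpow_natCast]
  linarith

/-- The single point x^* is already a packing. -/
lemma CostAssumption.constant_pos (hS : CostAssumption S A M C₀ α β f xs) (hA : 0 < A) :
    0 < C₀ := by
  have h := hS.packing 1 1 one_pos one_pos
  have h1 : (1 : ℕ∞) ≤ packingNumber {x | x ∈ domain S A ∧ f x - f xs < 1} 1 := by
    refine le_iSup₂_of_le {xs} ⟨?_, ?_⟩ (by simp)
    · intro x hx
      obtain rfl : x = xs := by simpa using hx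
      exact ⟨cube_subset_domain hS.minimizer_mem le_rfl (self_mem_cube _ hA.le), by simp⟩
    · simp
  have h2 : (1 : ENNReal) ≤ ENNReal.ofReal (C₀ * (1 + 1 ^ β / 1 ^ d)) :=
    le_trans (by simpa using ENat.toENNReal_le.2 h1) h
  rw [ENNReal.one_le_ofReal] at h2
  simp at h2
  nlinarith

/-- The number of bins of a given level with a small gap. -/
lemma CostAssumption.card_bins_le (hS : CostAssumption S A M C₀ α β f xs) (hA : 0 < A)
    (hc : InitialBins S A a₀ c) (hf : GapBounds a₀ c f xs M') {ε : ℝ} (hε : 0 < ε) (k : ℕ)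
    (F : Finset (Bin d m)) (hk : ∀ B ∈ F, B.level = k) (hF : ∀ B ∈ F, gap a₀ c f xs B ≤ ε) :
    (F.card : ℝ) ≤ m * (2 ^ d + 1) * (C₀ * (1 + (2 * ε) ^ β / (a₀ / 2 ^ k) ^ d)) := by
  classical
  have hC := hS.constant_pos hA
  have ha₀ := hf.side_pos
  set N : ℝ := C₀ * (1 + (2 * ε) ^ β / (a₀ / 2 ^ k) ^ d) with hN
  have hN0 : 0 ≤ N := by positivity
  choose! x hx hxle using fun B : Bin d m => hf.exists_le_gap B
  -- Points of adjacent bins can be arbitrarily close, so the bins are sorted by root and last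
  -- choice; within a class, the selected points are a side length apart. The value `none` is for
  -- the bins without a last choice, whence m (2^d + 1) classes.
  have hclass : ∀ q : Fin m × Option (Fin d → Bool),
      ((F.filter (fun B => (B.1, B.2.head?) = q)).card : ℝ) ≤ N := by
    intro q
    set Q := F.filter (fun B => (B.1, B.2.head?) = q) with hQ
    have hsep : ∀ B ∈ Q, ∀ B' ∈ Q, B ≠ B' → ∃ i, a₀ / 2 ^ k ≤ |x B i - x B' i| := by
      intro B hB B' hB' hne
      rw [hQ, Finset.mem_filter] at hB hB'
      have he := hB.2.trans hB'.2.symm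
      rw [Prod.mk.injEq] at he
      have := Bin.separated ha₀ he.1 ((hk B hB.1).trans (hk B' hB'.1).symm) he.2 hne
        (hx B) (hx B')
      simpa [Bin.side, hk B hB.1] using this
    have hinj : Set.InjOn x Q := by
      intro B hB B' hB' he
      by_contra hne
      obtain ⟨i, hi⟩ := hsep B hB B' hB' hne
      rw [he, sub_self, abs_zero] at hi
      have : 0 < a₀ / 2 ^ k := by positivity
      linarith
    -- The packing assumption concerns a strict sublevel set, so ε is doubled.
    have h1 : (Q.card : ℕ∞) ≤
        packingNumber {y | y ∈ domain S A ∧ f y - f xs < 2 * ε} (a₀ / 2 ^ k) := by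
      refine le_iSup₂_of_le (Q.image x) ⟨?_, ?_⟩ (by rw [Finset.card_image_of_injOn hinj])
      · intro y hy
        rw [Finset.coe_image] at hy
        obtain ⟨B, hB, rfl⟩ := hy
        refine ⟨hc.subset_domain B.1 (Bin.region_subset_root ha₀ B (hx B)), ?_⟩
        have := hF B (Finset.mem_filter.1 hB).1
        linarith [hxle B]
      · rw [Finset.coe_image]
        rintro _ ⟨B, hB, rfl⟩ _ ⟨B', hB', rfl⟩ hne
        exact disjoint_interior_cube (hsep B hB B' hB' fun h => hne (by rw [h]))
    have h2 : ((Q.card : ℕ) : ENNReal) ≤ ENNReal.ofReal N :=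
      le_trans (by simpa using ENat.toENNReal_le.2 h1)
        (hS.packing (a₀ / 2 ^ k) (2 * ε) (by positivity) (by positivity))
    rwa [← ENNReal.ofReal_natCast, ENNReal.ofReal_le_ofReal_iff hN0] at h2
  have hsum := Finset.card_eq_sum_card_fiberwise (s := F)
    (t := (Finset.univ : Finset (Fin m × Option (Fin d → Bool))))
    (f := fun B => (B.1, B.2.head?)) (fun _ _ => Finset.mem_coe.2 (Finset.mem_univ _))
  rw [hsum]
  push_cast
  refine (Finset.sum_le_card_nsmul _ _ N fun q _ => hclass q).trans ?_
  simp

end Assumption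

end Gap

/-! ### Deterministic properties of a run -/

section Dynamics

variable {d m : ℕ} {α a₀ : ℝ} {c : Fin m → Fin d → ℝ}

/-- `B'` is a proper descendant of `B`. -/
def Bin.Below (B B' : Bin d m) : Prop :=
  B.1 = B'.1 ∧ ∃ q : List (Fin d → Bool), q ≠ [] ∧ B'.2 = q ++ B.2

lemma Bin.Below.level_lt {B B' : Bin d m} (h : B.Below B') : B.level < B'.level := by
  obtain ⟨-, q, hq, he⟩ := h
  have := List.length_pos_iff.2 hq
  simp only [Bin.level, he, List.length_append]
  omega

lemma Bin.below_child (B : Bin d m) (l : Fin d → Bool) : B.Below (B.child l) :=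
  ⟨rfl, [l], by simp, rfl⟩

lemma Bin.Below.trans {B B' B'' : Bin d m} (h : B.Below B') (h' : B'.Below B'') :
    B.Below B'' := by
  obtain ⟨h1, q, hq, he⟩ := h
  obtain ⟨h1', q', hq', he'⟩ := h'
  exact ⟨h1.trans h1', q' ++ q, by simp [hq], by rw [he', he, List.append_assoc]⟩

/-- An ancestor of a child of `B` is `B` or an ancestor of `B`. -/
lemma Bin.Below.of_child {B B' : Bin d m} {l : Fin d → Bool} (h : B'.Below (B.child l)) :
    B' = B ∨ B'.Below B := by
  obtain ⟨h1, q, hq, he⟩ := h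
  cases q with
  | nil => exact absurd rfl hq
  | cons l' q =>
    simp only [Bin.child, List.cons_append, List.cons.injEq] at he h1
    by_cases hq' : q = []
    · subst hq'
      exact Or.inl (Prod.ext h1 (by simpa using he.2.symm))
    · exact Or.inr ⟨h1, q, hq', he.2⟩

/-- The bin in which a query `x` in the bin `B` is recorded. -/
noncomputable def Bin.recordBin (a₀ : ℝ) (c : Fin m → Fin d → ℝ) (full : Bool) (B : Bin d m)
    (x : Fin d → ℝ) : Bin d m :=
  if full then B.childAt a₀ c x else B

variable (α a₀ c) in
/-- In round `t + 1`, the picked bin is at capacity and is split. -/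
def SplitAt (b : ℕ → Bin d m) (x : ℕ → Fin d → ℝ) (t : ℕ) : Prop :=
  (b (t + 1)).capacity α ≤ ((stateAfter α a₀ c b x t).idx (b (t + 1))).card

noncomputable instance (b : ℕ → Bin d m) (x : ℕ → Fin d → ℝ) (t : ℕ) :
    Decidable (SplitAt α a₀ c b x t) := by
  unfold SplitAt; infer_instance

variable (α a₀ c) in
/-- The bin in which round `t` is recorded. -/
noncomputable def recordedIn (b : ℕ → Bin d m) (x : ℕ → Fin d → ℝ) (t : ℕ) : Bin d m :=
  Bin.recordBin a₀ c (decide (SplitAt α a₀ c b x (t - 1))) (b t) (x t)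

/-- The rounds up to `t` that are recorded in `B`, respectively in which `B` is picked, for the
sequences `recordedIn` and `b`. -/
def rounds (r : ℕ → Bin d m) (t : ℕ) (B : Bin d m) : Finset ℕ :=
  (Finset.Icc 1 t).filter (fun i => r i = B)

lemma rounds_zero (r : ℕ → Bin d m) (B : Bin d m) : rounds r 0 B = ∅ := by
  simp [rounds]

lemma rounds_succ (r : ℕ → Bin d m) (t : ℕ) (B : Bin d m) :
    rounds r (t + 1) B =
      if r (t + 1) = B then insert (t + 1) (rounds r t B) else rounds r t B := by
  have : Finset.Icc 1 (t + 1) = insert (t + 1) (Finset.Icc 1 t) := by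
    ext i; simp only [Finset.mem_Icc, Finset.mem_insert]; omega
  rw [rounds, this, Finset.filter_insert]
  rfl

lemma notMem_rounds (r : ℕ → Bin d m) (t : ℕ) (B : Bin d m) : t + 1 ∉ rounds r t B := by
  simp [rounds]

lemma card_rounds_succ (r : ℕ → Bin d m) (t : ℕ) (B : Bin d m) :
    (rounds r (t + 1) B).card = (rounds r t B).card + if r (t + 1) = B then 1 else 0 := by
  rw [rounds_succ]
  split_ifs
  · rw [Finset.card_insert_of_notMem (notMem_rounds r t B)]
  · rfl

lemma card_rounds_le (r : ℕ → Bin d m) (t : ℕ) (B : Bin d m) : (rounds r t B).card ≤ t :=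
  (Finset.card_filter_le _ _).trans (by simp)

/-- The invariants of the algorithm. -/
structure Invariant (α a₀ : ℝ) (c : Fin m → Fin d → ℝ) (b : ℕ → Bin d m) (x : ℕ → Fin d → ℝ)
    (t : ℕ) : Prop where
  idx_eq : ∀ B, (stateAfter α a₀ c b x t).idx B = rounds (recordedIn α a₀ c b x) t B
  fresh : ∀ B ∈ (stateAfter α a₀ c b x t).bins, ∀ B', B.Below B' →
    B' ∉ (stateAfter α a₀ c b x t).bins ∧ (stateAfter α a₀ c b x t).idx B' = ∅ ∧
      rounds b t B' = ∅
  card_le : ∀ B, ((stateAfter α a₀ c b x t).idx B).card ≤ B.capacity α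
  cover : ∀ (j : Fin m) (y : Fin d → ℝ), y ∈ Bin.region a₀ c ((j, []) : Bin d m) →
    ∃ B ∈ (stateAfter α a₀ c b x t).bins, y ∈ B.region a₀ c
  picks_le_card : ∀ B ∈ (stateAfter α a₀ c b x t).bins,
    (rounds b t B).card ≤ ((stateAfter α a₀ c b x t).idx B).card
  picks_le : ∀ B, (rounds b t B).card ≤ B.capacity α + 1
  parent : ∀ B ∈ (stateAfter α a₀ c b x t).bins, B.2 = [] ∨
    ∃ s < t, SplitAt α a₀ c b x s ∧ ∃ l, B = (b (s + 1)).child l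

variable {b : ℕ → Bin d m} {x : ℕ → Fin d → ℝ}

lemma Invariant.zero : Invariant α a₀ c b x 0 where
  idx_eq B := by simp [stateAfter, State.init, rounds_zero]
  fresh := by
    intro B hB B' hBB'
    refine ⟨fun hB' => ?_, rfl, rounds_zero _ _⟩
    simp only [stateAfter, State.init, Finset.mem_image, Finset.mem_univ, true_and] at hB'
    obtain ⟨j, rfl⟩ := hB'
    have := hBB'.level_lt
    simp [Bin.level] at this
  card_le B := by simp [stateAfter, State.init]
  cover j y hy := ⟨(j, []), by simp [stateAfter, State.init], hy⟩
  picks_le_card B _ := by simp [rounds_zero]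
  picks_le B := by simp [rounds_zero]
  parent B hB := by
    simp only [stateAfter, State.init, Finset.mem_image, Finset.mem_univ, true_and] at hB
    obtain ⟨j, rfl⟩ := hB
    exact Or.inl rfl

/-! ### Preservation of the invariants in one round -/

section Step

variable {t : ℕ}

lemma step_of_not_split (h : ¬ SplitAt α a₀ c b x t) :
    stateAfter α a₀ c b x (t + 1) =
      { bins := (stateAfter α a₀ c b x t).bins
        idx := Function.update (stateAfter α a₀ c b x t).idx (b (t + 1))
          (insert (t + 1) ((stateAfter α a₀ c b x t).idx (b (t + 1)))) } := by
  rw [stateAfter, State.step, if_pos (not_le.1 h)]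

lemma step_of_split (h : SplitAt α a₀ c b x t) :
    stateAfter α a₀ c b x (t + 1) =
      { bins := (stateAfter α a₀ c b x t).bins.erase (b (t + 1)) ∪ (b (t + 1)).children
        idx := Function.update (fun B' => if B' ∈ (b (t + 1)).children then ∅
            else (stateAfter α a₀ c b x t).idx B')
          ((b (t + 1)).childAt a₀ c (x (t + 1))) {t + 1} } := by
  rw [stateAfter, State.step, if_neg (not_lt.2 h)]

lemma recordedIn_of_not_split (h : ¬ SplitAt α a₀ c b x t) :
    recordedIn α a₀ c b x (t + 1) = b (t + 1) := by
  simp [recordedIn, Bin.recordBin, h]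

lemma recordedIn_of_split (h : SplitAt α a₀ c b x t) :
    recordedIn α a₀ c b x (t + 1) = (b (t + 1)).childAt a₀ c (x (t + 1)) := by
  simp [recordedIn, Bin.recordBin, h]

/-- Below a current bin nothing has been recorded yet, so resetting the children at a split erases
nothing. Both branches of the update thus only insert the new round into the recording bin. -/
lemma Invariant.idx_succ (hI : Invariant α a₀ c b x t)
    (hb : b (t + 1) ∈ (stateAfter α a₀ c b x t).bins) (B : Bin d m) :
    (stateAfter α a₀ c b x (t + 1)).idx B =
      if recordedIn α a₀ c b x (t + 1) = B then
        insert (t + 1) ((stateAfter α a₀ c b x t).idx B)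
      else (stateAfter α a₀ c b x t).idx B := by
  by_cases h : SplitAt α a₀ c b x t
  · have hch : ∀ B' ∈ (b (t + 1)).children, (stateAfter α a₀ c b x t).idx B' = ∅ := by
      intro B' hB'
      obtain ⟨l, rfl⟩ := Bin.mem_children.1 hB'
      exact (hI.fresh _ hb _ (Bin.below_child _ l)).2.1
    rw [step_of_split h, recordedIn_of_split h]
    by_cases hB : (b (t + 1)).childAt a₀ c (x (t + 1)) = B
    · subst hB
      simp [hch _ (Bin.childAt_mem_children _ _)]
    · simp only [Function.update_of_ne (Ne.symm hB), if_neg hB]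
      split_ifs with hc
      · exact (hch B hc).symm
      · rfl
  · rw [step_of_not_split h, recordedIn_of_not_split h]
    by_cases hB : b (t + 1) = B
    · subst hB; simp
    · simp [Function.update_of_ne (Ne.symm hB), hB]

lemma Invariant.notMem_idx (hI : Invariant α a₀ c b x t)
    (B : Bin d m) : t + 1 ∉ (stateAfter α a₀ c b x t).idx B := by
  rw [hI.idx_eq]; exact notMem_rounds _ _ _

lemma Invariant.card_idx_succ (hI : Invariant α a₀ c b x t)
    (hb : b (t + 1) ∈ (stateAfter α a₀ c b x t).bins) (B : Bin d m) :
    ((stateAfter α a₀ c b x (t + 1)).idx B).card = ((stateAfter α a₀ c b x t).idx B).card +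
      if recordedIn α a₀ c b x (t + 1) = B then 1 else 0 := by
  rw [hI.idx_succ hb]
  split_ifs
  · rw [Finset.card_insert_of_notMem (hI.notMem_idx B)]
  · rfl

/-- The field `fresh` drives the induction: when a bin is split, its children have neither picks nor
records. While a bin is current, each of its picks below capacity is also a record; the one pick
that splits it is recorded in a child. This is the extra 1 in `picks_le`. -/
lemma Invariant.succ (hI : Invariant α a₀ c b x t)
    (hb : b (t + 1) ∈ (stateAfter α a₀ c b x t).bins) : Invariant α a₀ c b x (t + 1) where
  idx_eq B := by rw [hI.idx_succ hb, rounds_succ, hI.idx_eq]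
  fresh := by
    intro B hB B' hBB'
    rw [hI.idx_succ hb, rounds_succ]
    by_cases h : SplitAt α a₀ c b x t
    · rw [recordedIn_of_split h]
      rw [step_of_split h] at hB ⊢
      simp only [Finset.mem_union, Finset.mem_erase] at hB ⊢
      rcases hB with ⟨hne, hB⟩ | hB
      · have hf := hI.fresh B hB B' hBB'
        have hnch : B' ∉ (b (t + 1)).children := by
          intro hc
          obtain ⟨l, rfl⟩ := Bin.mem_children.1 hc
          rcases hBB'.of_child with h1 | h1
          · exact hne h1
          · exact (hI.fresh B hB _ h1).1 hb
        have hnb : b (t + 1) ≠ B' := by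
          rintro rfl; exact hf.1 hb
        have hnr : (b (t + 1)).childAt a₀ c (x (t + 1)) ≠ B' := by
          rintro rfl; exact hnch (Bin.childAt_mem_children _ _)
        rw [if_neg hnr, if_neg hnb]
        exact ⟨by tauto, hf.2⟩
      · obtain ⟨l, rfl⟩ := Bin.mem_children.1 hB
        have hf := hI.fresh _ hb B' ((Bin.below_child _ l).trans hBB')
        have hlev := hBB'.level_lt
        have hnch : B' ∉ (b (t + 1)).children := by
          intro hc
          obtain ⟨l', rfl⟩ := Bin.mem_children.1 hc
          simp at hlev
        have hnb : b (t + 1) ≠ B' := by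
          rintro rfl; exact hf.1 hb
        have hnr : (b (t + 1)).childAt a₀ c (x (t + 1)) ≠ B' := by
          rintro rfl; exact hnch (Bin.childAt_mem_children _ _)
        rw [if_neg hnr, if_neg hnb]
        exact ⟨by tauto, hf.2⟩
    · rw [recordedIn_of_not_split h]
      rw [step_of_not_split h] at hB ⊢
      have hf := hI.fresh B hB B' hBB'
      have hnb : b (t + 1) ≠ B' := by
        rintro rfl; exact hf.1 hb
      rw [if_neg hnb, if_neg hnb]
      exact hf
  card_le B := by
    rw [hI.card_idx_succ hb]
    have h0 := hI.card_le B
    split_ifs with hr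
    · by_cases h : SplitAt α a₀ c b x t
      · rw [recordedIn_of_split h] at hr
        subst hr
        have hch := (hI.fresh _ hb ((b (t + 1)).childAt a₀ c (x (t + 1)))
          (Bin.below_child _ _)).2.1
        rw [hch]
        simpa using Bin.one_le_capacity α _
      · rw [recordedIn_of_not_split h] at hr
        subst hr
        exact not_le.1 h
    · simpa using h0
  cover j y hy := by
    obtain ⟨B, hB, hyB⟩ := hI.cover j y hy
    by_cases h : SplitAt α a₀ c b x t
    · rw [step_of_split h]
      by_cases hBb : B = b (t + 1)
      · subst hBb
        exact ⟨_, Finset.mem_union_right _ (Bin.childAt_mem_children _ y),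
          Bin.mem_region_childAt hyB⟩
      · exact ⟨B, Finset.mem_union_left _ (Finset.mem_erase.2 ⟨hBb, hB⟩), hyB⟩
    · rw [step_of_not_split h]
      exact ⟨B, hB, hyB⟩
  picks_le_card B hB := by
    rw [hI.card_idx_succ hb, card_rounds_succ]
    by_cases h : SplitAt α a₀ c b x t
    · rw [step_of_split h] at hB
      simp only [Finset.mem_union, Finset.mem_erase] at hB
      rcases hB with ⟨hne, hB⟩ | hB
      · rw [if_neg (Ne.symm hne)]
        exact (hI.picks_le_card B hB).trans (Nat.le_add_right _ _)
      · obtain ⟨l, rfl⟩ := Bin.mem_children.1 hB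
        have hne : b (t + 1) ≠ (b (t + 1)).child l := by
          intro he
          have := congrArg Bin.level he
          simp at this
        rw [if_neg hne, (hI.fresh _ hb _ (Bin.below_child _ l)).2.2]
        simp
    · rw [step_of_not_split h] at hB
      rw [recordedIn_of_not_split h]
      exact Nat.add_le_add_right (hI.picks_le_card B hB) _
  picks_le B := by
    rw [card_rounds_succ]
    split_ifs with hB
    · subst hB
      exact Nat.add_le_add_right ((hI.picks_le_card _ hb).trans (hI.card_le _)) 1
    · exact hI.picks_le B
  parent B hB := by
    have hold : B ∈ (stateAfter α a₀ c b x t).bins → B.2 = [] ∨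
        ∃ s < t + 1, SplitAt α a₀ c b x s ∧ ∃ l, B = (b (s + 1)).child l := by
      intro hB
      rcases hI.parent B hB with h0 | ⟨s, hs, h1⟩
      · exact Or.inl h0
      · exact Or.inr ⟨s, hs.trans (Nat.lt_succ_self t), h1⟩
    by_cases h : SplitAt α a₀ c b x t
    · rw [step_of_split h] at hB
      simp only [Finset.mem_union, Finset.mem_erase] at hB
      rcases hB with hB | hB
      · exact hold hB.2
      · obtain ⟨l, rfl⟩ := Bin.mem_children.1 hB
        exact Or.inr ⟨t, Nat.lt_succ_self t, h, l, rfl⟩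
    · rw [step_of_not_split h] at hB
      exact hold hB

end Step

lemma invariant (hb : ∀ t, b (t + 1) ∈ (stateAfter α a₀ c b x t).bins) (t : ℕ) :
    Invariant α a₀ c b x t := by
  induction t with
  | zero => exact Invariant.zero
  | succ t ih => exact ih.succ (hb t)

end Dynamics

/-! ### Relation between the exponents -/

section Exponents

variable {d : ℕ}

lemma mem_cube_two_mul_of_not_disjoint {x y : Fin d → ℝ} {a : ℝ}
    (h : ¬ Disjoint (interior (cube x a)) (interior (cube y a))) : x ∈ cube y (2 * a) := by
  have h' : ∀ i, |x i - y i| < a := by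
    intro i
    by_contra hi
    exact h (disjoint_interior_cube ⟨i, not_lt.1 hi⟩)
  constructor <;> intro i <;> have := abs_lt.1 (h' i) <;> simp only <;> linarith [this.1, this.2]

/-- For a packing of maximal cardinality, the cubes of twice the side length cover E, since an
uncovered point could be added to the packing. -/
lemma volume_le_of_packingNumber_le {E : Set (Fin d → ℝ)} {a N : ℝ} (ha : 0 < a) (hN : 0 ≤ N)
    (h : (packingNumber E a : ENNReal) ≤ ENNReal.ofReal N) :
    volume E ≤ ENNReal.ofReal (N * (2 * a) ^ d) := by
  classical
  set V : Finset (Fin d → ℝ) → Prop := fun P => (P : Set (Fin d → ℝ)) ⊆ E ∧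
    (P : Set (Fin d → ℝ)).PairwiseDisjoint (fun x => interior (cube x a)) with hV
  have hcard : ∀ P, V P → (P.card : ℝ) ≤ N := by
    intro P hP
    have h1 : (P.card : ℕ∞) ≤ packingNumber E a := le_iSup₂_of_le P hP le_rfl
    have h2 : (P.card : ENNReal) ≤ ENNReal.ofReal N :=
      le_trans (by simpa using ENat.toENNReal_le.2 h1) h
    rwa [← ENNReal.ofReal_natCast, ENNReal.ofReal_le_ofReal_iff hN] at h2
  obtain ⟨P, hP, hmax⟩ : ∃ P, V P ∧ ∀ Q, V Q → Q.card ≤ P.card := by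
    have hne : {n | ∃ P, V P ∧ P.card = n}.Nonempty := ⟨0, ∅, by simp [hV], rfl⟩
    have hbdd : BddAbove {n | ∃ P, V P ∧ P.card = n} := by
      refine ⟨⌈N⌉₊, ?_⟩
      rintro _ ⟨P, hP, rfl⟩
      exact_mod_cast (hcard P hP).trans (Nat.le_ceil N)
    obtain ⟨P, hP, he⟩ := Nat.sSup_mem hne hbdd
    exact ⟨P, hP, fun Q hQ => he ▸ le_csSup hbdd ⟨Q, hQ, rfl⟩⟩
  have hcover : E ⊆ ⋃ p ∈ P, cube p (2 * a) := by
    intro x hx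
    by_contra hnot
    simp only [Set.mem_iUnion, not_exists] at hnot
    have hxP : x ∉ P := fun hxP => hnot x hxP (self_mem_cube x (by positivity))
    have hins : V (insert x P) := by
      refine ⟨by simpa [Set.insert_subset_iff] using ⟨hx, hP.1⟩, ?_⟩
      rw [Finset.coe_insert, Set.pairwiseDisjoint_insert]
      refine ⟨hP.2, fun p hp _ => ?_⟩
      by_contra hd
      exact hnot p hp (mem_cube_two_mul_of_not_disjoint hd)
    have := hmax _ hins
    rw [Finset.card_insert_of_notMem hxP] at this
    omega
  calc volume E ≤ volume (⋃ p ∈ P, cube p (2 * a)) := measure_mono hcover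
    _ ≤ ∑ p ∈ P, volume (cube p (2 * a)) := measure_biUnion_finset_le _ _
    _ = ENNReal.ofReal (P.card * (2 * a) ^ d) := by
        simp only [volume_cube _ (mul_pos two_pos ha).le, Finset.sum_const, nsmul_eq_mul]
        rw [ENNReal.ofReal_mul (by positivity), ENNReal.ofReal_natCast]
    _ ≤ _ := ENNReal.ofReal_le_ofReal (by gcongr; exact hcard P hP)

variable {S : Set (Fin d → ℝ)} {A M C₀ α β : ℝ} {f : (Fin d → ℝ) → ℝ} {xs : Fin d → ℝ}

lemma CostAssumption.volume_sublevel_le (hS : CostAssumption S A M C₀ α β f xs) (hA : 0 < A)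
    (hd : 0 < d) {ε : ℝ} (hε : 0 < ε) :
    volume {x | x ∈ domain S A ∧ f x - f xs < ε} ≤
      ENNReal.ofReal (C₀ * 2 ^ (d + 1) * ε ^ β) := by
  have hC := hS.constant_pos hA
  have hεβ : 0 < ε ^ β := by positivity
  -- The scale ε^{β/d} makes the two terms of the packing bound equal.
  have ha : 0 < (ε ^ β) ^ ((d : ℝ)⁻¹) := by positivity
  have had : ((ε ^ β) ^ ((d : ℝ)⁻¹)) ^ d = ε ^ β := Real.rpow_inv_natCast_pow hεβ.le hd.ne'
  refine (volume_le_of_packingNumber_le ha (by positivity) (hS.packing _ ε ha hε)).trans ?_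
  refine ENNReal.ofReal_le_ofReal (le_of_eq ?_)
  rw [mul_pow, had, div_self hεβ.ne', pow_succ]
  ring

lemma CostAssumption.nonneg (hS : CostAssumption S A M C₀ α β f xs) : 0 ≤ M := by
  simpa using hS.gap_le xs hS.minimizer_mem

/-- Markov's inequality in a cube around x^*: the mean of f - f(x^*) there is at most M a^α, so at
least half of the cube lies below twice that level. Using M + 1 keeps the level positive if M = 0.
-/
lemma CostAssumption.le_volume_sublevel (hS : CostAssumption S A M C₀ α β f xs) {a : ℝ}
    (ha : 0 < a) (haA : a < A) :
    ENNReal.ofReal (a ^ d / 2) ≤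
      volume {x | x ∈ domain S A ∧ f x - f xs < 2 * (M + 1) * a ^ α} := by
  have hM := hS.nonneg
  set ε := 2 * (M + 1) * a ^ α with hε
  have hε0 : 0 < ε := by positivity
  have hv := volume_cube xs ha.le
  have hint : IntegrableOn (fun x => f x - f xs) (cube xs a) :=
    (hS.integrableOn _ ha haA xs hS.minimizer_mem).sub (integrableOn_const (by simp [hv]))
  have hsub := cube_subset_domain (A := A) hS.minimizer_mem haA.le
  have hmark := mul_meas_ge_le_integral_of_nonneg (μ := volume.restrict (cube xs a))
    (f := fun x => f x - f xs)
    (by filter_upwards [ae_restrict_mem measurableSet_Icc] with x hx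
        exact sub_nonneg.2 (hS.minimizer_le x (hsub hx))) hint ε
  have hle := hmark.trans (hS.integral_cube_le ha haA)
  have hfin : IsFiniteMeasure (volume.restrict (cube xs a)) :=
    ⟨by rw [Measure.restrict_apply_univ, hv]; exact ENNReal.ofReal_lt_top⟩
  have hms : MeasurableSet {x | ε ≤ f x - f xs} :=
    measurableSet_le measurable_const (hS.measurable.sub_const _)
  have hcompl : {x | ε ≤ f x - f xs}ᶜ = {x | f x - f xs < ε} := by ext x; simp
  have hsum := measureReal_add_measureReal_compl (μ := volume.restrict (cube xs a)) hms
  rw [hcompl, measureReal_restrict_apply_univ] at hsum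
  have hreal : (volume : Measure (Fin d → ℝ)).real (cube xs a) = a ^ d := by
    rw [Measure.real, hv, ENNReal.toReal_ofReal (by positivity)]
  rw [hreal] at hsum
  set u := (volume.restrict (cube xs a)).real {x | ε ≤ f x - f xs}
  have hu : u ≤ a ^ d / 2 := by
    have h0 : 0 < a ^ α := by positivity
    have h1 : 0 < a ^ d := by positivity
    have hlt : 2 * (M + 1) * u ≤ a ^ d * M := by
      refine le_of_mul_le_mul_right ?_ h0
      calc 2 * (M + 1) * u * a ^ α = ε * u := by rw [hε]; ring
        _ ≤ _ := hle
        _ = _ := by ring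
    by_contra hcon
    push Not at hcon
    nlinarith
  have hms' : MeasurableSet {x | f x - f xs < ε} :=
    measurableSet_lt (hS.measurable.sub_const _) measurable_const
  calc ENNReal.ofReal (a ^ d / 2)
      ≤ ENNReal.ofReal ((volume.restrict (cube xs a)).real {x | f x - f xs < ε}) :=
        ENNReal.ofReal_le_ofReal (by linarith)
    _ = (volume.restrict (cube xs a)) {x | f x - f xs < ε} := by
        rw [Measure.real, ENNReal.ofReal_toReal (measure_ne_top _ _)]
    _ = volume ({x | f x - f xs < ε} ∩ cube xs a) := Measure.restrict_apply hms'
    _ ≤ volume {x | x ∈ domain S A ∧ f x - f xs < ε} :=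
        measure_mono fun x hx => ⟨hsub hx.2, hx.1⟩

/-- The packing exponent of the sublevel sets is bounded in terms of the smoothness exponent. -/
lemma CostAssumption.mul_le (hS : CostAssumption S A M C₀ α β f xs) (hA : 0 < A) (hd : 0 < d) :
    α * β ≤ d := by
  by_contra hlt
  push Not at hlt
  have hC := hS.constant_pos hA
  have hM := hS.nonneg
  -- Comparing the two volume bounds for the same sublevel set gives a^d / 2 ≤ (K / 4) a^{αβ}. If αβ
  -- > d, this fails as soon as a^{αβ-d} ≤ 1/K.
  set K : ℝ := C₀ * 2 ^ (d + 1) * (2 * (M + 1)) ^ β * 4 with hK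
  have hK0 : 0 < K := by positivity
  set γ : ℝ := α * β - d with hγ
  have hγ0 : 0 < γ := by linarith
  set a : ℝ := min (A / 2) (K⁻¹ ^ γ⁻¹) with ha_def
  have ha : 0 < a := lt_min (by positivity) (by positivity)
  have haA : a < A := (min_le_left _ _).trans_lt (by linarith)
  have haγ : a ^ γ ≤ K⁻¹ := by
    calc a ^ γ ≤ (K⁻¹ ^ γ⁻¹) ^ γ := Real.rpow_le_rpow ha.le (min_le_right _ _) hγ0.le
      _ = K⁻¹ := Real.rpow_inv_rpow (by positivity) hγ0.ne'
  have h := (hS.le_volume_sublevel ha haA).trans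
    (hS.volume_sublevel_le hA hd (ε := 2 * (M + 1) * a ^ α) (by positivity))
  rw [ENNReal.ofReal_le_ofReal_iff (by positivity), Real.mul_rpow (by positivity) (by positivity),
    ← Real.rpow_mul ha.le] at h
  have hsplit : a ^ (α * β) = a ^ d * a ^ γ := by
    rw [← Real.rpow_natCast, ← Real.rpow_add ha]; congr 1; rw [hγ]; ring
  rw [hsplit] at h
  have had : 0 < a ^ d := by positivity
  have h2 : a ^ d / 2 ≤ a ^ d * (1 / 4) := by
    calc a ^ d / 2 ≤ C₀ * 2 ^ (d + 1) * ((2 * (M + 1)) ^ β * (a ^ d * a ^ γ)) := h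
      _ = a ^ d * (K * a ^ γ / 4) := by rw [hK]; ring
      _ ≤ a ^ d * (K * K⁻¹ / 4) := by gcongr
      _ = a ^ d * (1 / 4) := by rw [mul_inv_cancel₀ hK0.ne']
  linarith

end Exponents

/-! ### Exponential moments of the responses -/

section Moments

variable {d m : ℕ} {a₀ : ℝ} {c : Fin m → Fin d → ℝ} {f : (Fin d → ℝ) → ℝ} {xs : Fin d → ℝ}
  {M' : ℝ}

/-- The variance proxy of the responses. -/
noncomputable def varProxy (M' : ℝ) : ℝ := 1 + (M' / 2) ^ 2

lemma varProxy_pos (M' : ℝ) : 0 < varProxy M' := by unfold varProxy; positivity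

/-- The expectation over the noise of the compensated exponential of the centered response. -/
noncomputable def noiseMean (f : (Fin d → ℝ) → ℝ) (M' lam e : ℝ) (x : Fin d → ℝ) : ENNReal :=
  ∫⁻ w, ENNReal.ofReal (Real.exp (lam * (f x + w - e) - lam ^ 2 * varProxy M' / 2))
    ∂(gaussianReal 0 1)

lemma measurable_expTerm (hf : Measurable f) (M' lam e : ℝ) :
    Measurable (fun p : (Fin d → ℝ) × ℝ =>
      ENNReal.ofReal (Real.exp (lam * (f p.1 + p.2 - e) - lam ^ 2 * varProxy M' / 2))) := by
  have h2 : Measurable (fun p : (Fin d → ℝ) × ℝ => f p.1) := hf.comp measurable_fst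
  fun_prop

lemma measurable_noiseMean (hf : Measurable f) (M' lam e : ℝ) :
    Measurable (noiseMean f M' lam e) :=
  (measurable_expTerm hf M' lam e).lintegral_prod_right'

/-- The exponential moment of the Gaussian noise cancels the summand 1 of `varProxy`. The summand
(M'/2)^2 is left for the randomness of the query. -/
lemma noiseMean_eq (f : (Fin d → ℝ) → ℝ) (M' lam e : ℝ) (x : Fin d → ℝ) :
    noiseMean f M' lam e x =
      ENNReal.ofReal (Real.exp (lam * (f x - e) - lam ^ 2 * (M' / 2) ^ 2 / 2)) := by
  have hint : Integrable (fun w : ℝ => Real.exp (lam * w)) (gaussianReal 0 1) :=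
    integrable_exp_mul_gaussianReal lam
  have hmgf := congrFun (mgf_fun_id_gaussianReal (μ := 0) (v := 1)) lam
  simp only [mgf, zero_mul, zero_add, NNReal.coe_one, one_mul] at hmgf
  have hsplit : ∀ w : ℝ,
      ENNReal.ofReal (Real.exp (lam * (f x + w - e) - lam ^ 2 * varProxy M' / 2)) =
      ENNReal.ofReal (Real.exp (lam * (f x - e) - lam ^ 2 * varProxy M' / 2)) *
        ENNReal.ofReal (Real.exp (lam * w)) := by
    intro w
    rw [← ENNReal.ofReal_mul (Real.exp_pos _).le, ← Real.exp_add]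
    congr 2; ring
  simp only [noiseMean, hsplit]
  rw [lintegral_const_mul _ (by fun_prop),
    ← ofReal_integral_eq_lintegral_ofReal hint (ae_of_all _ fun w => (Real.exp_pos _).le), hmgf,
    ← ENNReal.ofReal_mul (Real.exp_pos _).le, ← Real.exp_add]
  congr 2; unfold varProxy; ring

/-- The mean cost in a bin. -/
noncomputable def meanCost (a₀ : ℝ) (c : Fin m → Fin d → ℝ) (f : (Fin d → ℝ) → ℝ)
    (xs : Fin d → ℝ) (B : Bin d m) : ℝ :=
  f xs + gap a₀ c f xs B

/-- Hoeffding's lemma for f - f(x^*), which takes values in [0, M'] on the bin. -/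
lemma GapBounds.lintegral_noiseMean_le (hf : GapBounds a₀ c f xs M') (lam : ℝ) (B : Bin d m) :
    ∫⁻ u, noiseMean f M' lam (meanCost a₀ c f xs B) (B.point a₀ c u) ∂(unif d) ≤ 1 := by
  have hsub := hasSubgaussianMGF_of_mem_Icc (hf.measurable_gap_point B).aemeasurable
    (hf.ae_mem B)
  have hint := hsub.integrable_exp_mul lam
  have hle := hsub.mgf_le lam
  have hc : (((‖M' - 0‖₊ / 2) ^ 2 : NNReal) : ℝ) = (M' / 2) ^ 2 := by
    simp [div_pow]
  rw [hc] at hle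
  rw [show (∫ u, (f (B.point a₀ c u) - f xs) ∂(unif d)) = gap a₀ c f xs B from rfl] at hint hle
  have hsplit : ∀ u, noiseMean f M' lam (meanCost a₀ c f xs B) (B.point a₀ c u) =
      ENNReal.ofReal (Real.exp (-(lam ^ 2 * (M' / 2) ^ 2 / 2))) *
        ENNReal.ofReal (Real.exp (lam * (f (B.point a₀ c u) - f xs - gap a₀ c f xs B))) := by
    intro u
    rw [noiseMean_eq, ← ENNReal.ofReal_mul (Real.exp_pos _).le, ← Real.exp_add, meanCost]
    congr 2; ring
  simp only [hsplit]
  have hm := hf.measurable_gap_point B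
  rw [lintegral_const_mul _ (by fun_prop),
    ← ofReal_integral_eq_lintegral_ofReal hint (ae_of_all _ fun w => (Real.exp_pos _).le),
    ← ENNReal.ofReal_mul (Real.exp_pos _).le]
  rw [← ENNReal.ofReal_one]
  refine ENNReal.ofReal_le_ofReal ?_
  rw [mgf] at hle
  calc _ ≤ Real.exp (-(lam ^ 2 * (M' / 2) ^ 2 / 2)) *
        Real.exp ((M' / 2) ^ 2 * lam ^ 2 / 2) := by gcongr
    _ = 1 := by rw [← Real.exp_add, ← Real.exp_zero]; congr 1; ring

/-- The points of the unit cube that belong to the child with label `l`. -/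
def childCell (l : Fin d → Bool) : Set (Fin d → ℝ) := {u | ∀ i, decide (1 / 2 ≤ u i) = l i}

lemma measurableSet_childCell (l : Fin d → Bool) : MeasurableSet (childCell l) := by
  rw [childCell, Set.ofPred_forall]
  refine MeasurableSet.iInter fun i => ?_
  cases l i
  · simp only [decide_eq_false_iff_not, not_le]
    exact measurableSet_lt (measurable_pi_apply i) measurable_const
  · simp only [decide_eq_true_eq]
    exact measurableSet_le measurable_const (measurable_pi_apply i)

lemma childAt_point (ha₀ : 0 < a₀) (B : Bin d m) (l : Fin d → Bool) (u : Fin d → ℝ) :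
    B.childAt a₀ c (B.point a₀ c u) = B.child l ↔ u ∈ childCell l := by
  have hs := B.side_pos ha₀
  have : ∀ i, (B.corner a₀ c i + B.side a₀ / 2 ≤ B.corner a₀ c i + B.side a₀ * u i) ↔
      1 / 2 ≤ u i := by
    intro i
    rw [add_le_add_iff_left, div_eq_mul_one_div]
    exact mul_le_mul_iff_right₀ hs
  rw [Bin.childAt, B.child_injective.eq_iff, funext_iff]
  simp only [Bin.point, this, childCell, Set.mem_ofPred_eq]

lemma unif_childCell (l : Fin d → Bool) :
    unif d (childCell l) = ENNReal.ofReal ((1 / 2) ^ d) := by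
  have h : childCell l ∩ Set.Icc (0 : Fin d → ℝ) 1 =
      Set.pi Set.univ (fun i => if l i then Set.Icc (1 / 2 : ℝ) 1 else Set.Ico 0 (1 / 2)) := by
    ext u
    simp only [childCell, Set.mem_inter_iff, Set.mem_ofPred_eq, Set.mem_Icc, Pi.le_def,
      Set.mem_pi, Set.mem_univ, forall_true_left, Pi.zero_apply, Pi.one_apply]
    rw [← forall_and, ← forall_and]
    refine forall_congr' fun i => ?_
    cases l i
    · simp only [decide_eq_false_iff_not, not_le, Bool.false_eq_true, if_false, Set.mem_Ico]
      constructor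
      · rintro ⟨h1, h2, h3⟩; exact ⟨h2, h1⟩
      · rintro ⟨h1, h2⟩; exact ⟨h2, h1, by linarith⟩
    · simp only [decide_eq_true_eq, if_true, Set.mem_Icc]
      constructor
      · rintro ⟨h1, h2, h3⟩; exact ⟨h1, h3⟩
      · rintro ⟨h1, h2⟩; exact ⟨h1, by linarith, h2⟩
  rw [unif, Measure.restrict_apply (measurableSet_childCell l), h, volume_pi_pi]
  have : ∀ i, (volume (if l i then Set.Icc (1 / 2 : ℝ) 1 else Set.Ico 0 (1 / 2)) : ENNReal) =
      ENNReal.ofReal (1 / 2) := by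
    intro i
    split_ifs
    · rw [Real.volume_Icc]; norm_num
    · rw [Real.volume_Ico]; norm_num
  simp only [this, Finset.prod_const, Finset.card_univ, Fintype.card_fin]
  rw [ENNReal.ofReal_pow (by norm_num)]

/-- A uniform point of a bin, restricted to the cell of a child, is uniform in that child with total
mass 2^{-d}. Enlarging the cell to a closed cube is harmless, as only an upper bound is needed. -/
lemma setLIntegral_childCell_le (B : Bin d m) (l : Fin d → Bool)
    {h : (Fin d → ℝ) → ENNReal} (hh : Measurable h) :
    ∫⁻ u in childCell l, h (B.point a₀ c u) ∂(unif d) ≤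
      ENNReal.ofReal ((1 / 2) ^ d) * ∫⁻ u, h ((B.child l).point a₀ c u) ∂(unif d) := by
  set p : Fin d → ℝ := fun i => if l i then 1 / 2 else 0 with hp
  have hsub : childCell l ∩ Set.Icc (0 : Fin d → ℝ) 1 ⊆ Set.Icc p (fun i => p i + 1 / 2) := by
    rintro u ⟨h1, h2, h3⟩
    have h' : ∀ i, p i ≤ u i ∧ u i ≤ p i + 1 / 2 := by
      intro i
      have e1 := h1 i
      have e2 : 0 ≤ u i := h2 i
      have e3 : u i ≤ 1 := h3 i
      simp only [hp]
      cases hl : l i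
      · rw [hl, decide_eq_false_iff_not, not_le] at e1
        simp only [Bool.false_eq_true, if_false]
        constructor <;> linarith
      · rw [hl, decide_eq_true_eq] at e1
        simp only [if_true]
        constructor <;> linarith
    exact ⟨fun i => (h' i).1, fun i => (h' i).2⟩
  have hpt : ∀ u : Fin d → ℝ, B.point a₀ c (fun i => p i + 1 / 2 * u i) =
      (B.child l).point a₀ c u := by
    intro u
    funext i
    simp only [Bin.point, Bin.corner_child, Bin.side_child, hp]
    split_ifs <;> ring
  rw [unif, Measure.restrict_restrict (measurableSet_childCell l)]
  refine (lintegral_mono_set hsub).trans (le_of_eq ?_)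
  rw [setLIntegral_Icc_eq p (s := 1 / 2) (h := fun u => h (B.point a₀ c u)) (by norm_num)
    (hh.comp B.measurable_point)]
  simp only [hpt, unif]

/-- Recording a response in a bin does not increase the compensated exponential. -/
lemma GapBounds.lintegral_record_le (hf : GapBounds a₀ c f xs M') (lam : ℝ) (B B' : Bin d m)
    (q : Bool) :
    ∫⁻ p, {p : (Fin d → ℝ) × ℝ | Bin.recordBin a₀ c q B' (B'.point a₀ c p.1) = B}.indicator
      (fun p => ENNReal.ofReal (Real.exp (lam * (f (B'.point a₀ c p.1) + p.2 -
        meanCost a₀ c f xs B) - lam ^ 2 * varProxy M' / 2))) p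
        ∂((unif d).prod (gaussianReal 0 1)) ≤
    ∫⁻ p, {p : (Fin d → ℝ) × ℝ | Bin.recordBin a₀ c q B' (B'.point a₀ c p.1) = B}.indicator
      (fun _ => 1) p ∂((unif d).prod (gaussianReal 0 1)) := by
  set e := meanCost a₀ c f xs B with he
  have hmeas : Measurable (fun p : (Fin d → ℝ) × ℝ => ENNReal.ofReal (Real.exp
      (lam * (f (B'.point a₀ c p.1) + p.2 - e) - lam ^ 2 * varProxy M' / 2))) := by
    have h2 : Measurable (fun p : (Fin d → ℝ) × ℝ => f (B'.point a₀ c p.1)) :=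
      hf.measurable.comp (B'.measurable_point.comp measurable_fst)
    have key : ∀ F : (Fin d → ℝ) × ℝ → ℝ, Measurable F → Measurable (fun p =>
        ENNReal.ofReal (Real.exp (lam * (F p + p.2 - e) - lam ^ 2 * varProxy M' / 2))) :=
      fun F hF => by fun_prop
    exact key _ h2
  cases q with
  | false =>
    simp only [Bin.recordBin, Bool.false_eq_true, if_false]
    by_cases hB : B' = B
    · subst hB
      simp only [Set.ofPred_true, Set.indicator_univ, lintegral_const, measure_univ, mul_one]
      rw [lintegral_prod _ hmeas.aemeasurable]
      exact hf.lintegral_noiseMean_le lam B'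
    · simp [hB]
  | true =>
    simp only [Bin.recordBin, if_true]
    by_cases hB : ∃ l, B = B'.child l
    · obtain ⟨l, rfl⟩ := hB
      have hset : {p : (Fin d → ℝ) × ℝ | B'.childAt a₀ c (B'.point a₀ c p.1) = B'.child l} =
          childCell l ×ˢ Set.univ := by
        ext p
        simp [childAt_point hf.side_pos B' l p.1]
      have hmc := measurableSet_childCell (d := d) l
      rw [hset, lintegral_indicator (hmc.prod MeasurableSet.univ),
        lintegral_indicator (hmc.prod MeasurableSet.univ)]
      simp only [lintegral_one, Measure.restrict_apply_univ, Measure.prod_prod, measure_univ,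
        mul_one, unif_childCell]
      rw [← Measure.prod_restrict, Measure.restrict_univ, lintegral_prod _ hmeas.aemeasurable]
      -- The mass 2^{-d} of the cell appears on both sides; what remains is the moment bound for a
      -- uniform point of the child.
      refine (setLIntegral_childCell_le B' l
        (measurable_noiseMean hf.measurable M' lam e)).trans ?_
      exact mul_le_of_le_one_right' (hf.lintegral_noiseMean_le lam (B'.child l))
    · have : ∀ x, B'.childAt a₀ c x ≠ B := fun x hx => hB ⟨_, hx.symm⟩
      simp [this]

end Moments

/-! ### Measurability along a run -/

section CountableFibers

variable {Ω ι E : Type*} [mΩ : MeasurableSpace Ω] [MeasurableSpace E]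

/-- There are only countably many bins, so measurability in a random bin is tested with the bin
frozen at each of its values. No σ-algebra on bins is needed. -/
lemma measurableSet_of_countable_fibers [Countable ι] {g : Ω → ι}
    (hg : ∀ k, MeasurableSet {ω | g ω = k}) {s : ι → Set Ω} (hs : ∀ k, MeasurableSet (s k)) :
    MeasurableSet {ω | ω ∈ s (g ω)} := by
  have : {ω | ω ∈ s (g ω)} = ⋃ k, {ω | g ω = k} ∩ s k := by
    ext ω; simp
  rw [this]
  exact MeasurableSet.iUnion fun k => (hg k).inter (hs k)

lemma measurable_of_countable_fibers [Countable ι] {g : Ω → ι}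
    (hg : ∀ k, MeasurableSet {ω | g ω = k}) {F : ι → Ω → E} (hF : ∀ k, Measurable (F k)) :
    Measurable (fun ω => F (g ω) ω) :=
  fun s hs => measurableSet_of_countable_fibers hg (s := fun k => F k ⁻¹' s) fun k => hF k hs

lemma measurableSet_prodMk_decide {g : Ω → ι} (hg : ∀ k, MeasurableSet {ω | g ω = k}) {s : Set Ω}
    [∀ ω, Decidable (ω ∈ s)] (hs : MeasurableSet s) (k : ι × Bool) :
    MeasurableSet {ω | (g ω, decide (ω ∈ s)) = k} := by
  obtain ⟨i, q⟩ := k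
  have : {ω | (g ω, decide (ω ∈ s)) = (i, q)} =
      {ω | g ω = i} ∩ (if q then s else sᶜ) := by
    ext ω
    cases q <;> simp
  rw [this]
  refine (hg i).inter ?_
  split_ifs
  exacts [hs, hs.compl]

variable {d m : ℕ}

lemma measurable_card_rounds {r : ℕ → Ω → Bin d m} (B : Bin d m) {t : ℕ}
    (hr : ∀ i < t, MeasurableSet {ω | r (i + 1) ω = B}) :
    Measurable (fun ω => (rounds (fun i => r i ω) t B).card) := by
  induction t with
  | zero => simp only [rounds_zero]; exact measurable_const
  | succ t ih =>
    simp only [card_rounds_succ]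
    exact (ih fun i hi => hr i (hi.trans (Nat.lt_succ_self t))).add
      (Measurable.ite (hr t (Nat.lt_succ_self t)) measurable_const measurable_const)

lemma sum_rounds_succ (r : ℕ → Bin d m) (y : ℕ → ℝ) (t : ℕ) (B : Bin d m) :
    ∑ i ∈ rounds r (t + 1) B, y i =
      ∑ i ∈ rounds r t B, y i + if r (t + 1) = B then y (t + 1) else 0 := by
  rw [rounds_succ]
  split_ifs
  · rw [Finset.sum_insert (notMem_rounds r t B), add_comm]
  · rw [add_zero]

lemma measurable_sum_rounds {r : ℕ → Ω → Bin d m} {y : ℕ → Ω → ℝ} (B : Bin d m) {t : ℕ}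
    (hr : ∀ i < t, MeasurableSet {ω | r (i + 1) ω = B}) (hy : ∀ i < t, Measurable (y (i + 1))) :
    Measurable (fun ω => ∑ i ∈ rounds (fun i => r i ω) t B, y i ω) := by
  induction t with
  | zero => simp only [rounds_zero]; exact measurable_const
  | succ t ih =>
    have h1 := ih (fun i hi => hr i (hi.trans (Nat.lt_succ_self t)))
      (fun i hi => hy i (hi.trans (Nat.lt_succ_self t)))
    have h2 : ∀ ω, ∑ i ∈ rounds (fun i => r i ω) (t + 1) B, y i ω =
        ∑ i ∈ rounds (fun i => r i ω) t B, y i ω + if r (t + 1) ω = B then y (t + 1) ω else 0 :=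
      fun ω => sum_rounds_succ (fun i => r i ω) (fun i => y i ω) t B
    simp only [h2]
    exact h1.add (Measurable.ite (hr t (Nat.lt_succ_self t)) (hy t (Nat.lt_succ_self t))
      measurable_const)

end CountableFibers

/-! ### Predictability of the splits, and integration over one round -/

section Run

variable {d m : ℕ} {α a₀ μ : ℝ} {c : Fin m → Fin d → ℝ} {f : (Fin d → ℝ) → ℝ}
  {xs : Fin d → ℝ} {M' : ℝ}

lemma measurableSet_childAt (B B' : Bin d m) : MeasurableSet {x | B'.childAt a₀ c x = B} := by
  by_cases hB : ∃ l, B'.child l = B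
  · obtain ⟨l, rfl⟩ := hB
    simp only [Bin.childAt, B'.child_injective.eq_iff, funext_iff]
    rw [Set.ofPred_forall]
    refine MeasurableSet.iInter fun i => ?_
    cases l i
    · simp only [decide_eq_false_iff_not, not_le]
      exact measurableSet_lt (measurable_pi_apply i) measurable_const
    · simp only [decide_eq_true_eq]
      exact measurableSet_le measurable_const (measurable_pi_apply i)
  · have : ∀ x, B'.childAt a₀ c x ≠ B := fun x hx => hB ⟨_, hx⟩
    simp [this]

lemma measurableSet_recordBin (q : Bool) (B B' : Bin d m) :
    MeasurableSet {x | Bin.recordBin a₀ c q B' x = B} := by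
  cases q
  · simp [Bin.recordBin]
  · simpa [Bin.recordBin] using measurableSet_childAt B B'

variable {Ω : Type*} [mΩ : MeasurableSpace Ω] {P : Measure Ω}
  {ℱ : Filtration ℕ mΩ} {b : ℕ → Ω → Bin d m} {U X : ℕ → Ω → Fin d → ℝ} {W Y : ℕ → Ω → ℝ}

variable (α a₀ c b X) in
/-- The bin in which round `t` of a run is recorded. -/
noncomputable def record (t : ℕ) (ω : Ω) : Bin d m :=
  recordedIn α a₀ c (fun s => b s ω) (fun s => X s ω) t

variable (α a₀ c b X) in
/-- The outcomes for which the bin picked in round `t + 1` is split. -/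
def splitEvent (t : ℕ) : Set Ω := {ω | SplitAt α a₀ c (fun s => b s ω) (fun s => X s ω) t}

namespace IsRun

lemma invariant (h : IsRun α a₀ μ c f P ℱ b U X W Y) (ω : Ω) (t : ℕ) :
    Invariant α a₀ c (fun s => b s ω) (fun s => X s ω) t :=
  AdaptiveBandit.invariant (fun t => h.pick_mem t ω) t

lemma query_eq_point (h : IsRun α a₀ μ c f P ℱ b U X W Y) (t : ℕ) (ω : Ω) :
    X (t + 1) ω = (b (t + 1) ω).point a₀ c (U (t + 1) ω) :=
  funext fun i => h.query_eq t ω i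

lemma measurable_query (h : IsRun α a₀ μ c f P ℱ b U X W Y)
    (t : ℕ) : Measurable[ℱ (t + 1)] (X (t + 1)) := by
  rw [show X (t + 1) = fun ω => (b (t + 1) ω).point a₀ c (U (t + 1) ω) from
    funext fun ω => h.query_eq_point t ω]
  exact measurable_of_countable_fibers (mΩ := ℱ (t + 1)) (g := b (t + 1))
    (fun k => ℱ.mono (Nat.le_succ t) _ (h.pick_measurable t k))
    (F := fun B ω => B.point a₀ c (U (t + 1) ω))
    (fun B => B.measurable_point.comp (h.unif_measurable t))

lemma measurable_response (h : IsRun α a₀ μ c f P ℱ b U X W Y)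
    (hf : Measurable f) (t : ℕ) : Measurable[ℱ (t + 1)] (Y (t + 1)) := by
  rw [show Y (t + 1) = fun ω => f (X (t + 1) ω) + W (t + 1) ω from
    funext fun ω => h.response_eq t ω]
  exact Measurable.add (hf.comp (h.measurable_query t)) (h.noise_measurable t)

lemma mem_splitEvent_iff (h : IsRun α a₀ μ c f P ℱ b U X W Y)
    (t : ℕ) (ω : Ω) : ω ∈ splitEvent α a₀ c b X t ↔
    (b (t + 1) ω).capacity α ≤
      (rounds (fun i => record α a₀ c b X i ω) t (b (t + 1) ω)).card := by
  have h1 : ω ∈ splitEvent α a₀ c b X t ↔ (b (t + 1) ω).capacity α ≤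
    ((stateAfter α a₀ c (fun s => b s ω) (fun s => X s ω) t).idx (b (t + 1) ω)).card := Iff.rfl
  rw [h1, (h.invariant ω t).idx_eq]
  rfl

lemma record_eq (h : IsRun α a₀ μ c f P ℱ b U X W Y)
    (t : ℕ) (ω : Ω) [Decidable (ω ∈ splitEvent α a₀ c b X t)] :
    record α a₀ c b X (t + 1) ω =
      Bin.recordBin a₀ c (decide (ω ∈ splitEvent α a₀ c b X t)) (b (t + 1) ω)
        ((b (t + 1) ω).point a₀ c (U (t + 1) ω)) := by
  rw [record, recordedIn, ← h.query_eq_point]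
  exact congrArg (fun q => Bin.recordBin a₀ c q _ _) (decide_eq_decide.2 Iff.rfl)

/-- Both claims are proved together: whether round t + 1 splits depends on the picked bin and on
where the rounds up to t are recorded; where round t + 1 is recorded depends on this and on the new
query. -/
lemma measurableSet_split_record (h : IsRun α a₀ μ c f P ℱ b U X W Y)
    (t : ℕ) : MeasurableSet[ℱ t] (splitEvent α a₀ c b X t) ∧
    ∀ B, MeasurableSet[ℱ (t + 1)] {ω | record α a₀ c b X (t + 1) ω = B} := by
  classical
  induction t using Nat.strong_induction_on with
  | _ t ih =>
    have hsplit : MeasurableSet[ℱ t] (splitEvent α a₀ c b X t) := by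
      have he : splitEvent α a₀ c b X t = {ω | ω ∈ (fun B : Bin d m => {ω | B.capacity α ≤
          (rounds (fun i => record α a₀ c b X i ω) t B).card}) (b (t + 1) ω)} := by
        ext ω; exact h.mem_splitEvent_iff t ω
      rw [he]
      refine measurableSet_of_countable_fibers (mΩ := ℱ t) (g := b (t + 1))
        (h.pick_measurable t) (s := fun B : Bin d m => {ω | B.capacity α ≤
          (rounds (fun i => record α a₀ c b X i ω) t B).card}) fun B => ?_
      have hm := measurable_card_rounds (mΩ := ℱ t) (r := record α a₀ c b X) B (t := t)
        (fun i hi => ℱ.mono hi _ ((ih i hi).2 B))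
      exact hm (measurableSet_Ici (a := B.capacity α))
    refine ⟨hsplit, fun B => ?_⟩
    have hfib : ∀ k : Bin d m × Bool, MeasurableSet[ℱ (t + 1)]
        {ω | (b (t + 1) ω, decide (ω ∈ splitEvent α a₀ c b X t)) = k} := by
      exact fun k => ℱ.mono (Nat.le_succ t) _
        (measurableSet_prodMk_decide (mΩ := ℱ t) (h.pick_measurable t) hsplit k)
    have he : {ω | record α a₀ c b X (t + 1) ω = B} =
        {ω | ω ∈ (fun k : Bin d m × Bool => {ω | Bin.recordBin a₀ c k.2 k.1
          (X (t + 1) ω) = B}) (b (t + 1) ω, decide (ω ∈ splitEvent α a₀ c b X t))} := by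
      ext ω
      simp only [Set.mem_ofPred_eq, h.record_eq, h.query_eq_point]
    rw [he]
    exact measurableSet_of_countable_fibers (mΩ := ℱ (t + 1)) hfib fun k =>
      h.measurable_query t (measurableSet_recordBin k.2 B k.1)

lemma measurableSet_split (h : IsRun α a₀ μ c f P ℱ b U X W Y)
    (t : ℕ) : MeasurableSet[ℱ t] (splitEvent α a₀ c b X t) :=
  (h.measurableSet_split_record t).1

lemma measurableSet_record (h : IsRun α a₀ μ c f P ℱ b U X W Y)
    {i t : ℕ} (hi : i < t) (B : Bin d m) :
    MeasurableSet[ℱ t] {ω | record α a₀ c b X (i + 1) ω = B} :=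
  ℱ.mono hi _ ((h.measurableSet_split_record i).2 B)

/-- Integrating out the randomness of a round, given the past. -/
lemma lintegral_fresh (h : IsRun α a₀ μ c f P ℱ b U X W Y)
    [IsProbabilityMeasure P] {κ : Type*} [Countable κ] {t : ℕ} {ξ : Ω → κ}
    (hξ : ∀ k, MeasurableSet[ℱ t] {ω | ξ ω = k}) {H : Ω → ENNReal} (hH : Measurable[ℱ t] H)
    {g : κ → (Fin d → ℝ) × ℝ → ENNReal} (hg : ∀ k, Measurable (g k)) :
    ∫⁻ ω, H ω * g (ξ ω) (U (t + 1) ω, W (t + 1) ω) ∂P =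
      ∫⁻ ω, H ω * ∫⁻ p, g (ξ ω) p ∂((unif d).prod (gaussianReal 0 1)) ∂P := by
  classical
  have hU : Measurable (U (t + 1)) := (h.unif_measurable t).mono (ℱ.le _) le_rfl
  have hW : Measurable (W (t + 1)) := (h.noise_measurable t).mono (ℱ.le _) le_rfl
  have hUW : Measurable (fun ω => (U (t + 1) ω, W (t + 1) ω)) := hU.prodMk hW
  have hlaw : P.map (fun ω => (U (t + 1) ω, W (t + 1) ω)) =
      (unif d).prod (gaussianReal 0 1) := by
    rw [(indepFun_iff_map_prod_eq_prod_map_map hU.aemeasurable hW.aemeasurable).1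
      (h.unif_indep_noise t), h.unif_law, h.noise_law]
    rfl
  have hHk : ∀ k, Measurable[ℱ t] ({ω | ξ ω = k}.indicator H) := fun k => hH.indicator (hξ k)
  -- Independence applies to a fixed integrand only, so the integral is split according to the
  -- countably many values of ξ.
  have hsplit : ∀ G : κ → Ω → ENNReal, (∀ k, Measurable (G k)) →
      ∫⁻ ω, H ω * G (ξ ω) ω ∂P = ∑' k, ∫⁻ ω, {ω | ξ ω = k}.indicator H ω * G k ω ∂P := by
    intro G hG
    rw [← lintegral_tsum (f := fun k ω => {ω | ξ ω = k}.indicator H ω * G k ω) fun k =>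
      (((hHk k).mono (ℱ.le t) le_rfl).mul (hG k)).aemeasurable]
    refine lintegral_congr fun ω => ?_
    rw [tsum_eq_single (ξ ω)]
    · simp
    · intro k hk
      rw [Set.indicator_of_notMem (by simpa using Ne.symm hk), zero_mul]
  rw [hsplit (fun k ω => g k (U (t + 1) ω, W (t + 1) ω)) (fun k => (hg k).comp hUW),
    hsplit (fun k _ => ∫⁻ p, g k p ∂((unif d).prod (gaussianReal 0 1)))
      (fun k => measurable_const)]
  refine tsum_congr fun k => ?_
  have hcomap : MeasurableSpace.comap (fun ω => (U (t + 1) ω, W (t + 1) ω)) inferInstance ≤ mΩ :=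
    hUW.comap_le
  rw [lintegral_mul_eq_lintegral_mul_lintegral_of_independent_measurableSpace
    (f := {ω | ξ ω = k}.indicator H) (g := fun ω => g k (U (t + 1) ω, W (t + 1) ω))
    (ℱ.le t) hcomap (h.indep_past t).symm (hHk k)
    ((hg k).comp (comap_measurable _)), ← hlaw, lintegral_map (hg k) hUW,
    lintegral_mul_const _ ((hHk k).mono (ℱ.le t) le_rfl)]

open Classical in
/-- One round does not increase the compensated exponential of a bin. -/
lemma lintegral_round_le (h : IsRun α a₀ μ c f P ℱ b U X W Y)
    [IsProbabilityMeasure P] (hf : GapBounds a₀ c f xs M') (lam : ℝ)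
    (B : Bin d m) (t : ℕ) {H : Ω → ENNReal} (hH : Measurable[ℱ t] H) :
    ∫⁻ ω, H ω * {ω | record α a₀ c b X (t + 1) ω = B}.indicator (fun ω => ENNReal.ofReal
      (Real.exp (lam * (Y (t + 1) ω - meanCost a₀ c f xs B) - lam ^ 2 * varProxy M' / 2))) ω ∂P ≤
    ∫⁻ ω, H ω * {ω | record α a₀ c b X (t + 1) ω = B}.indicator (fun _ => 1) ω ∂P := by
  -- The past enters the new record only through the picked bin and whether it is full. Given these
  -- two, the record is a function of the fresh point.
  set ξ : Ω → Bin d m × Bool := fun ω => (b (t + 1) ω, decide (ω ∈ splitEvent α a₀ c b X t))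
    with hξ_def
  have hξ : ∀ k, MeasurableSet[ℱ t] {ω | ξ ω = k} := by
    exact measurableSet_prodMk_decide (mΩ := ℱ t) (h.pick_measurable t) (h.measurableSet_split t)
  set D : Bin d m × Bool → Set ((Fin d → ℝ) × ℝ) := fun k =>
    {p | Bin.recordBin a₀ c k.2 k.1 (k.1.point a₀ c p.1) = B} with hD
  have hDm : ∀ k, MeasurableSet (D k) := fun k =>
    (k.1.measurable_point.comp measurable_fst) (measurableSet_recordBin k.2 B k.1)
  set E : Bin d m × Bool → (Fin d → ℝ) × ℝ → ENNReal := fun k p =>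
    ENNReal.ofReal (Real.exp (lam * (f (k.1.point a₀ c p.1) + p.2 - meanCost a₀ c f xs B) -
      lam ^ 2 * varProxy M' / 2)) with hE
  have hEm : ∀ k, Measurable (E k) := by
    intro k
    have h2 : Measurable (fun p : (Fin d → ℝ) × ℝ => f (k.1.point a₀ c p.1)) :=
      hf.measurable.comp (k.1.measurable_point.comp measurable_fst)
    have key : ∀ F : (Fin d → ℝ) × ℝ → ℝ, Measurable F → Measurable (fun p =>
        ENNReal.ofReal (Real.exp (lam * (F p + p.2 - meanCost a₀ c f xs B) -
          lam ^ 2 * varProxy M' / 2))) :=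
      fun F hF => by fun_prop
    exact key _ h2
  have hmem : ∀ ω, (U (t + 1) ω, W (t + 1) ω) ∈ D (ξ ω) ↔
      record α a₀ c b X (t + 1) ω = B := by
    intro ω
    rw [h.record_eq]
    rfl
  have hl : ∀ ω, {ω | record α a₀ c b X (t + 1) ω = B}.indicator (fun ω => ENNReal.ofReal
      (Real.exp (lam * (Y (t + 1) ω - meanCost a₀ c f xs B) - lam ^ 2 * varProxy M' / 2))) ω =
      (D (ξ ω)).indicator (E (ξ ω)) (U (t + 1) ω, W (t + 1) ω) := by
    intro ω
    by_cases hω : record α a₀ c b X (t + 1) ω = B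
    · rw [Set.indicator_of_mem (by exact hω), Set.indicator_of_mem ((hmem ω).2 hω),
        h.response_eq, h.query_eq_point]
    · rw [Set.indicator_of_notMem (by exact hω),
        Set.indicator_of_notMem (fun hc => hω ((hmem ω).1 hc))]
  have hr : ∀ ω, {ω | record α a₀ c b X (t + 1) ω = B}.indicator (fun _ => (1 : ENNReal)) ω =
      (D (ξ ω)).indicator (fun _ => 1) (U (t + 1) ω, W (t + 1) ω) := by
    intro ω
    by_cases hω : record α a₀ c b X (t + 1) ω = B
    · rw [Set.indicator_of_mem (by exact hω), Set.indicator_of_mem ((hmem ω).2 hω)]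
    · rw [Set.indicator_of_notMem (by exact hω),
        Set.indicator_of_notMem (fun hc => hω ((hmem ω).1 hc))]
  simp only [hl, hr]
  rw [h.lintegral_fresh hξ hH (g := fun k => (D k).indicator (E k))
      (fun k => (hEm k).indicator (hDm k)),
    h.lintegral_fresh hξ hH (g := fun k => (D k).indicator (fun _ => 1))
      (fun k => measurable_const.indicator (hDm k))]
  refine lintegral_mono fun ω => ?_
  refine mul_le_mul' le_rfl ?_
  exact hf.lintegral_record_le lam B (ξ ω).1 (ξ ω).2

end IsRun

end Run

/-! ### Concentration of the means of the responses -/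

section Concentration

variable {d m : ℕ} {α a₀ μ : ℝ} {c : Fin m → Fin d → ℝ} {f : (Fin d → ℝ) → ℝ}
  {xs : Fin d → ℝ} {M' : ℝ}
variable {Ω : Type*} [mΩ : MeasurableSpace Ω] {P : Measure Ω}
  {ℱ : Filtration ℕ mΩ} {b : ℕ → Ω → Bin d m} {U X : ℕ → Ω → Fin d → ℝ} {W Y : ℕ → Ω → ℝ}

variable (α a₀ c b X) in
/-- The rounds up to `t` that are recorded in `B`. -/
noncomputable def recorded (t : ℕ) (B : Bin d m) (ω : Ω) : Finset ℕ :=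
  rounds (fun i => record α a₀ c b X i ω) t B

variable (α a₀ c f xs b X Y) in
/-- The sum of the centered responses that are recorded in `B` up to round `t`. -/
noncomputable def centeredSum (t : ℕ) (B : Bin d m) (ω : Ω) : ℝ :=
  ∑ i ∈ recorded α a₀ c b X t B ω, (Y i ω - meanCost a₀ c f xs B)

open Classical in
variable (α a₀ c f xs b X Y M') in
/-- The compensated exponential of the centered responses in a bin with recorded rounds. -/
noncomputable def compensated (lam : ℝ) (t : ℕ) (B : Bin d m) (ω : Ω) : ENNReal :=
  if (recorded α a₀ c b X t B ω).card = 0 then 0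
  else ENNReal.ofReal (Real.exp (lam * centeredSum α a₀ c f xs b X Y t B ω -
    (recorded α a₀ c b X t B ω).card * (lam ^ 2 * varProxy M' / 2)))

namespace IsRun

lemma measurable_card_recorded (h : IsRun α a₀ μ c f P ℱ b U X W Y) (t : ℕ) (B : Bin d m) :
    Measurable[ℱ t] (fun ω => (recorded α a₀ c b X t B ω).card) :=
  measurable_card_rounds (mΩ := ℱ t) (r := record α a₀ c b X) B
    fun _ hi => h.measurableSet_record hi B

lemma measurable_centeredSum (h : IsRun α a₀ μ c f P ℱ b U X W Y)
    (hf : Measurable f) (t : ℕ) (B : Bin d m) :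
    Measurable[ℱ t] (centeredSum α a₀ c f xs b X Y t B) :=
  measurable_sum_rounds (mΩ := ℱ t) (r := record α a₀ c b X)
    (y := fun i ω => Y i ω - meanCost a₀ c f xs B) B
    (fun _ hi => h.measurableSet_record hi B)
    (fun i hi => ((h.measurable_response hf i).mono (ℱ.mono hi) le_rfl).sub_const _)

lemma measurable_compensated (h : IsRun α a₀ μ c f P ℱ b U X W Y)
    (hf : Measurable f) (lam : ℝ) (t : ℕ) (B : Bin d m) :
    Measurable[ℱ t] (compensated α a₀ c f xs M' b X Y lam t B) := by
  have h1 := h.measurable_card_recorded t B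
  have h2 := h.measurable_centeredSum (xs := xs) hf t B
  refine Measurable.ite (h1 (measurableSet_singleton 0)) measurable_const ?_
  have h3 : Measurable[ℱ t] (fun ω => ((recorded α a₀ c b X t B ω).card : ℝ)) :=
    measurable_from_top.comp h1
  exact ENNReal.measurable_ofReal.comp (Real.measurable_exp.comp
    ((h2.const_mul lam).sub (h3.mul_const _)))

/-- The compensated exponential is a supermartingale apart from its start: it is 0 while B has no
record and is restarted from 1 at the first one. Each round thus adds at most the probability of
being recorded in B. Starting from 0 matters because the bounds are summed over infinitely many
bins, most of which are never reached. -/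
lemma lintegral_compensated_le (h : IsRun α a₀ μ c f P ℱ b U X W Y)
    [IsProbabilityMeasure P] (hf : GapBounds a₀ c f xs M') (lam : ℝ)
    (B : Bin d m) (t : ℕ) :
    ∫⁻ ω, compensated α a₀ c f xs M' b X Y lam t B ω ∂P ≤
      ∑ i ∈ Finset.range t, P {ω | record α a₀ c b X (i + 1) ω = B} := by
  classical
  induction t with
  | zero => simp [compensated, recorded, rounds_zero]
  | succ t ih =>
    rw [Finset.sum_range_succ]
    set A : Set Ω := {ω | record α a₀ c b X (t + 1) ω = B} with hA_def
    have hA : MeasurableSet A := (ℱ.le (t + 1)) _ (h.measurableSet_record (Nat.lt_succ_self t) B)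
    set Q := compensated α a₀ c f xs M' b X Y lam t B with hQ_def
    have hQ : Measurable[ℱ t] Q := h.measurable_compensated hf.measurable lam t B
    have hQ' : Measurable Q := hQ.mono (ℱ.le t) le_rfl
    set e : Ω → ENNReal := fun ω => ENNReal.ofReal (Real.exp
      (lam * (Y (t + 1) ω - meanCost a₀ c f xs B) - lam ^ 2 * varProxy M' / 2)) with he_def
    -- The summand 1 is needed only at the first record, where Q is 0; at later records it is just
    -- an overestimate.
    have hpt : ∀ ω, compensated α a₀ c f xs M' b X Y lam (t + 1) B ω ≤
        Aᶜ.indicator Q ω + (Q ω + 1) * A.indicator e ω := by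
      intro ω
      by_cases hω : ω ∈ A
      · have hr : record α a₀ c b X (t + 1) ω = B := hω
        have hcard : (recorded α a₀ c b X (t + 1) B ω).card =
            (recorded α a₀ c b X t B ω).card + 1 := by
          rw [recorded, card_rounds_succ, if_pos hr]; rfl
        have hsum : centeredSum α a₀ c f xs b X Y (t + 1) B ω =
            centeredSum α a₀ c f xs b X Y t B ω + (Y (t + 1) ω - meanCost a₀ c f xs B) := by
          rw [centeredSum, recorded, sum_rounds_succ, if_pos hr]; rfl
        rw [Set.indicator_of_notMem (by simpa using hω), Set.indicator_of_mem hω, zero_add,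
          compensated, if_neg (by omega), hcard, hsum, hQ_def, compensated]
        by_cases h0 : (recorded α a₀ c b X t B ω).card = 0
        · have hs0 : centeredSum α a₀ c f xs b X Y t B ω = 0 := by
            rw [centeredSum, Finset.card_eq_zero.1 h0, Finset.sum_empty]
          rw [if_pos h0, h0, hs0]
          simp [he_def]
        · rw [if_neg h0, he_def]
          refine le_trans (le_of_eq ?_) (mul_le_mul' le_self_add le_rfl)
          rw [← ENNReal.ofReal_mul (Real.exp_pos _).le, ← Real.exp_add]
          congr 2
          push_cast
          ring
      · have hr : ¬ record α a₀ c b X (t + 1) ω = B := hω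
        have hrec : recorded α a₀ c b X (t + 1) B ω = recorded α a₀ c b X t B ω := by
          rw [recorded, rounds_succ, if_neg hr]; rfl
        rw [Set.indicator_of_mem (by simpa using hω), Set.indicator_of_notMem hω, mul_zero,
          add_zero, hQ_def, compensated, compensated, centeredSum, centeredSum, hrec]
    calc ∫⁻ ω, compensated α a₀ c f xs M' b X Y lam (t + 1) B ω ∂P
        ≤ ∫⁻ ω, (Aᶜ.indicator Q ω + (Q ω + 1) * A.indicator e ω) ∂P := lintegral_mono hpt
      _ = ∫⁻ ω, Aᶜ.indicator Q ω ∂P + ∫⁻ ω, (Q ω + 1) * A.indicator e ω ∂P :=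
          lintegral_add_left (hQ'.indicator hA.compl) _
      _ ≤ ∫⁻ ω, Aᶜ.indicator Q ω ∂P + ∫⁻ ω, (Q ω + 1) * A.indicator (fun _ => 1) ω ∂P := by
          refine add_le_add le_rfl ?_
          exact h.lintegral_round_le hf lam B t (hQ.add_const 1)
      _ = ∫⁻ ω, Aᶜ.indicator Q ω ∂P + ∫⁻ ω, (A.indicator Q ω + A.indicator (fun _ => 1) ω) ∂P := by
          congr 1
          refine lintegral_congr fun ω => ?_
          by_cases hω : ω ∈ A <;> simp [hω]
      _ = ∫⁻ ω, Aᶜ.indicator Q ω ∂P + (∫⁻ ω, A.indicator Q ω ∂P + P A) := by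
          rw [lintegral_add_left (hQ'.indicator hA), lintegral_indicator_const hA, one_mul]
      _ = ∫⁻ ω, Q ω ∂P + P A := by
          rw [lintegral_indicator hA, lintegral_indicator hA.compl, ← add_assoc,
            add_comm (∫⁻ ω in Aᶜ, Q ω ∂P), lintegral_add_compl Q hA]
      _ ≤ _ := by gcongr

/-- Chernoff's bound with σ = ±1 for the two tails. Fixing the number n of records lets the
exponential parameter depend on n. The weight is the expected number of records in B, not 1, and so
is summable over the bins. -/
lemma measure_deviation_le (h : IsRun α a₀ μ c f P ℱ b U X W Y)
    [IsProbabilityMeasure P] (hf : GapBounds a₀ c f xs M') (B : Bin d m)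
    {t n : ℕ} (hn : 0 < n) {σ L : ℝ} (hσ : σ ^ 2 = 1) (hL : 0 ≤ L) :
    P {ω | (recorded α a₀ c b X t B ω).card = n ∧
        √n * (L / 2) < σ * centeredSum α a₀ c f xs b X Y t B ω} ≤
      ENNReal.ofReal (Real.exp (-(L ^ 2 / (8 * varProxy M')))) *
        ∑ i ∈ Finset.range t, P {ω | record α a₀ c b X (i + 1) ω = B} := by
  set v := varProxy M' with hv_def
  have hv : 0 < v := varProxy_pos M'
  -- The optimal parameter x / (n v) for the threshold x = √n L / 2; the resulting exponent is x^2 /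
  -- (2 n v) = L^2 / (8 v).
  set lam : ℝ := σ * (L / (2 * v * √n)) with hlam
  have hsq : 0 < √(n : ℝ) := Real.sqrt_pos.2 (by exact_mod_cast hn)
  have hn2 : √(n : ℝ) ^ 2 = n := Real.sq_sqrt (by positivity)
  have hQ : Measurable (compensated α a₀ c f xs M' b X Y lam t B) :=
    (h.measurable_compensated hf.measurable lam t B).mono (ℱ.le t) le_rfl
  set E : ℝ := Real.exp (L ^ 2 / (8 * v)) with hE
  have hsub : {ω | (recorded α a₀ c b X t B ω).card = n ∧
      √n * (L / 2) < σ * centeredSum α a₀ c f xs b X Y t B ω} ⊆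
      {ω | ENNReal.ofReal E ≤ compensated α a₀ c f xs M' b X Y lam t B ω} := by
    rintro ω ⟨h1, h2⟩
    show ENNReal.ofReal E ≤ compensated α a₀ c f xs M' b X Y lam t B ω
    rw [compensated, if_neg (by omega), h1]
    refine ENNReal.ofReal_le_ofReal (Real.exp_le_exp.2 ?_)
    have h3 : L / (2 * v * √n) * (√n * (L / 2)) ≤
        L / (2 * v * √n) * (σ * centeredSum α a₀ c f xs b X Y t B ω) :=
      mul_le_mul_of_nonneg_left h2.le (by positivity)
    have h4 : L / (2 * v * √n) * (√n * (L / 2)) = L ^ 2 / (4 * v) := by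
      field_simp; ring
    have h5 : (n : ℝ) * (lam ^ 2 * v / 2) = L ^ 2 / (8 * v) := by
      rw [hlam, mul_pow, hσ, one_mul, div_pow, mul_pow, hn2]
      have : (n : ℝ) ≠ 0 := by positivity
      field_simp; ring
    rw [h5]
    have h6 : lam * centeredSum α a₀ c f xs b X Y t B ω =
      L / (2 * v * √n) * (σ * centeredSum α a₀ c f xs b X Y t B ω) := by rw [hlam]; ring
    have h7 : L ^ 2 / (4 * v) = L ^ 2 / (8 * v) + L ^ 2 / (8 * v) := by field_simp; ring
    linarith
  have hmark := mul_meas_ge_le_lintegral (μ := P) hQ (ENNReal.ofReal E)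
  have hinv : ENNReal.ofReal (Real.exp (-(L ^ 2 / (8 * v)))) * ENNReal.ofReal E = 1 := by
    rw [← ENNReal.ofReal_mul (Real.exp_pos _).le, hE, ← Real.exp_add]; simp
  calc _ ≤ P {ω | ENNReal.ofReal E ≤ compensated α a₀ c f xs M' b X Y lam t B ω} :=
        measure_mono hsub
    _ = ENNReal.ofReal (Real.exp (-(L ^ 2 / (8 * v)))) * (ENNReal.ofReal E *
          P {ω | ENNReal.ofReal E ≤ compensated α a₀ c f xs M' b X Y lam t B ω}) := by
        rw [← mul_assoc, hinv, one_mul]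
    _ ≤ _ := mul_le_mul' le_rfl (hmark.trans (h.lintegral_compensated_le hf lam B t))

end IsRun

variable (α a₀ c f xs b X Y) in
/-- After round `t`, the mean response in some bin deviates from the mean cost. -/
def deviationEvent (t : ℕ) : Set Ω :=
  {ω | ∃ B : Bin d m, (recorded α a₀ c b X t B ω).card ≠ 0 ∧
    √((recorded α a₀ c b X t B ω).card : ℝ) * (Real.log t / 2) <
      |centeredSum α a₀ c f xs b X Y t B ω|}

/-- With y = ln t, the square (y - 20 v)^2 ≥ 0 gives 5 y ≤ y^2 / (8 v) + 50 v. The power t^{-3}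
leaves a summable t^{-2} after multiplication by the O(t) rounds that a deviation can spoil. -/
lemma two_mul_sq_mul_exp_le {v : ℝ} (hv : 0 < v) {t : ℝ} (ht : 0 < t) :
    2 * t ^ 2 * Real.exp (-(Real.log t ^ 2 / (8 * v))) ≤ 2 * Real.exp (50 * v) / t ^ 3 := by
  have h1 : t ^ 2 = Real.exp (2 * Real.log t) := by
    rw [mul_comm, Real.exp_mul, Real.exp_log ht]; norm_cast
  have h2 : t ^ 3 = Real.exp (3 * Real.log t) := by
    rw [mul_comm, Real.exp_mul, Real.exp_log ht]; norm_cast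
  rw [h1, h2, mul_assoc, ← Real.exp_add, mul_div_assoc, ← Real.exp_sub]
  refine mul_le_mul_of_nonneg_left (Real.exp_le_exp.2 ?_) two_pos.le
  generalize Real.log t = y
  have h3 : 5 * y ≤ y ^ 2 / (8 * v) + 50 * v := by
    rw [div_add' _ _ _ (by positivity), le_div_iff₀ (by positivity)]
    nlinarith [sq_nonneg (y - 20 * v)]
  linarith

namespace IsRun

lemma measurableSet_deviationEvent (h : IsRun α a₀ μ c f P ℱ b U X W Y)
    (hf : Measurable f) (t : ℕ) :
    MeasurableSet (deviationEvent α a₀ c f xs b X Y t) := by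
  rw [deviationEvent, Set.ofPred_exists]
  refine MeasurableSet.iUnion fun B => ?_
  have h1 : Measurable (fun ω => (recorded α a₀ c b X t B ω).card) :=
    (h.measurable_card_recorded t B).mono (ℱ.le t) le_rfl
  have h2 : Measurable (centeredSum α a₀ c f xs b X Y t B) :=
    (h.measurable_centeredSum hf t B).mono (ℱ.le t) le_rfl
  have h3 : Measurable (fun ω => ((recorded α a₀ c b X t B ω).card : ℝ)) :=
    measurable_from_top.comp h1
  refine MeasurableSet.inter (h1 (measurableSet_singleton 0)).compl ?_
  exact measurableSet_lt (h3.sqrt.mul_const _) (measurable_norm.comp h2)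

lemma tsum_measure_record (h : IsRun α a₀ μ c f P ℱ b U X W Y) [IsProbabilityMeasure P] (i : ℕ) :
    ∑' B, P {ω | record α a₀ c b X (i + 1) ω = B} = 1 := by
  rw [← measure_iUnion]
  · have : (⋃ B, {ω | record α a₀ c b X (i + 1) ω = B}) = Set.univ := by
      ext ω; simp
    rw [this, measure_univ]
  · intro B B' hne
    rw [Function.onFun, Set.disjoint_left]
    intro ω h1 h2
    exact hne (h1.symm.trans h2)
  · exact fun B => (ℱ.le (i + 1)) _ (h.measurableSet_record (Nat.lt_succ_self i) B)

/-- Union bound over the bins, the two signs and the at most t possible numbers of records. -/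
lemma measure_deviationEvent_le (h : IsRun α a₀ μ c f P ℱ b U X W Y)
    [IsProbabilityMeasure P] (hf : GapBounds a₀ c f xs M') {t : ℕ}
    (ht : 0 < t) : P (deviationEvent α a₀ c f xs b X Y t) ≤
      ENNReal.ofReal (2 * Real.exp (50 * varProxy M') / (t : ℝ) ^ 3) := by
  set L := Real.log t with hL
  have hL0 : 0 ≤ L := Real.log_natCast_nonneg t
  set E := ENNReal.ofReal (Real.exp (-(L ^ 2 / (8 * varProxy M')))) with hE
  set D : ℝ → Bin d m → ℕ → Set Ω := fun σ B n => {ω | (recorded α a₀ c b X t B ω).card = n ∧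
        √n * (L / 2) < σ * centeredSum α a₀ c f xs b X Y t B ω} with hD
  set R : Bin d m → ENNReal := fun B =>
    ∑ i ∈ Finset.range t, P {ω | record α a₀ c b X (i + 1) ω = B} with hR
  have hsub : deviationEvent α a₀ c f xs b X Y t ⊆
      ⋃ B, ⋃ n ∈ Finset.Icc 1 t, (D 1 B n ∪ D (-1) B n) := by
    rintro ω ⟨B, h1, h2⟩
    have hle : (recorded α a₀ c b X t B ω).card ≤ t := card_rounds_le _ _ _
    simp only [Set.mem_iUnion]
    refine ⟨B, _, Finset.mem_Icc.2 ⟨Nat.one_le_iff_ne_zero.2 h1, hle⟩, ?_⟩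
    rcases lt_abs.1 h2 with h3 | h3
    · exact Or.inl ⟨rfl, by rwa [one_mul]⟩
    · exact Or.inr ⟨rfl, by rwa [neg_one_mul]⟩
  have hB : ∀ B, P (⋃ n ∈ Finset.Icc 1 t, (D 1 B n ∪ D (-1) B n)) ≤ t * (2 * (E * R B)) := by
    intro B
    refine (measure_biUnion_finset_le _ _).trans ?_
    refine (Finset.sum_le_card_nsmul _ _ (2 * (E * R B)) fun n hn => ?_).trans ?_
    · have hn0 : 0 < n := (Finset.mem_Icc.1 hn).1
      refine (measure_union_le _ _).trans ?_
      rw [two_mul]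
      exact add_le_add (h.measure_deviation_le hf B hn0 (by norm_num) hL0)
        (h.measure_deviation_le hf B hn0 (by norm_num) hL0)
    · simp [nsmul_eq_mul]
  -- Each of the t rounds is recorded in exactly one bin, so the weights of all bins add up to t.
  have hsum : ∑' B, R B = t := by
    rw [hR, Summable.tsum_finsetSum (fun i _ => ENNReal.summable)]
    simp [h.tsum_measure_record]
  calc P (deviationEvent α a₀ c f xs b X Y t)
      ≤ ∑' B, P (⋃ n ∈ Finset.Icc 1 t, (D 1 B n ∪ D (-1) B n)) :=
        (measure_mono hsub).trans (measure_iUnion_le _)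
    _ ≤ ∑' B, t * (2 * (E * R B)) := ENNReal.tsum_le_tsum hB
    _ = t * (2 * (E * t)) := by
        rw [ENNReal.tsum_mul_left, ENNReal.tsum_mul_left, ENNReal.tsum_mul_left, hsum]
    _ = ENNReal.ofReal (2 * (t : ℝ) ^ 2 * Real.exp (-(L ^ 2 / (8 * varProxy M')))) := by
        rw [ENNReal.ofReal_mul (by positivity), ENNReal.ofReal_mul two_pos.le,
          ENNReal.ofReal_pow (by positivity), ENNReal.ofReal_natCast, ENNReal.ofReal_ofNat, ← hE]
        ring
    _ ≤ _ := ENNReal.ofReal_le_ofReal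
        (two_mul_sq_mul_exp_le (varProxy_pos M') (by exact_mod_cast ht))

end IsRun

end Concentration

/-! ### The gap of the bins that are split -/

section SplitGap

variable {d m : ℕ} {α β A M C₀ a₀ μ : ℝ} {S : Set (Fin d → ℝ)} {c : Fin m → Fin d → ℝ}
  {f : (Fin d → ℝ) → ℝ} {xs : Fin d → ℝ} {M' : ℝ}
variable {Ω : Type*} [mΩ : MeasurableSpace Ω] {P : Measure Ω}
  {ℱ : Filtration ℕ mΩ} {b : ℕ → Ω → Bin d m} {U X : ℕ → Ω → Fin d → ℝ} {W Y : ℕ → Ω → ℝ}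

/-- The factor `2^{-αk}`. -/
noncomputable def rate (α : ℝ) (k : ℕ) : ℝ := (2 : ℝ) ^ (-(α * k))

lemma rate_pos (α : ℝ) (k : ℕ) : 0 < rate α k := by unfold rate; positivity

lemma two_rpow_eq_inv_rate_sq (α : ℝ) (k : ℕ) :
    (2 : ℝ) ^ (2 * α * (k : ℝ)) = ((rate α k)⁻¹) ^ 2 := by
  rw [rate, ← Real.rpow_neg two_pos.le, neg_neg, ← Real.rpow_natCast, ← Real.rpow_mul two_pos.le]
  congr 1; push_cast; ring

lemma inv_rate_sq_le_capacity (α : ℝ) (B : Bin d m) :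
    ((rate α B.level)⁻¹) ^ 2 ≤ B.capacity α := by
  rw [← two_rpow_eq_inv_rate_sq]; exact Nat.le_ceil _

lemma side_rpow (ha₀ : 0 < a₀) (B : Bin d m) :
    B.side a₀ ^ α = a₀ ^ α * rate α B.level := by
  rw [Bin.side, Real.div_rpow ha₀.le (by positivity), rate, ← Real.rpow_natCast,
    ← Real.rpow_mul two_pos.le, Real.rpow_neg two_pos.le, mul_comm α]
  rfl

lemma inv_sqrt_le_rate {B : Bin d m} {n : ℕ} (hn : B.capacity α ≤ n) :
    (√(n : ℝ))⁻¹ ≤ rate α B.level := by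
  have hr := rate_pos α B.level
  have h1 : ((rate α B.level)⁻¹) ^ 2 ≤ (n : ℝ) :=
    (inv_rate_sq_le_capacity α B).trans (by exact_mod_cast hn)
  have h2 : (rate α B.level)⁻¹ ≤ √(n : ℝ) := Real.le_sqrt_of_sq_le h1
  exact inv_le_of_inv_le₀ hr h2

namespace IsRun

lemma idx_eq_recorded (h : IsRun α a₀ μ c f P ℱ b U X W Y) (t : ℕ) (ω : Ω) (B : Bin d m) :
    (stateAfter α a₀ c (fun r => b r ω) (fun r => X r ω) t).idx B =
      recorded α a₀ c b X t B ω :=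
  (h.invariant ω t).idx_eq B

lemma lcb_eq_bot (h : IsRun α a₀ μ c f P ℱ b U X W Y)
    {t : ℕ} {ω : Ω} {B : Bin d m} (hB : (recorded α a₀ c b X t B ω).card = 0) :
    (stateAfter α a₀ c (fun r => b r ω) (fun r => X r ω) t).lcb α a₀ μ
      (fun r => Y r ω) t B = ⊥ := by
  rw [State.lcb, h.idx_eq_recorded, if_pos (Finset.card_eq_zero.1 hB)]

lemma lcb_eq (h : IsRun α a₀ μ c f P ℱ b U X W Y) (xs : Fin d → ℝ) {t : ℕ} {ω : Ω} {B : Bin d m}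
    (hB : (recorded α a₀ c b X t B ω).card ≠ 0) :
    (stateAfter α a₀ c (fun r => b r ω) (fun r => X r ω) t).lcb α a₀ μ
      (fun r => Y r ω) t B =
    ((meanCost a₀ c f xs B + centeredSum α a₀ c f xs b X Y t B ω /
        (recorded α a₀ c b X t B ω).card - μ * B.side a₀ ^ α -
        (√((recorded α a₀ c b X t B ω).card : ℝ))⁻¹ * Real.log t : ℝ) : EReal) := by
  have hne : recorded α a₀ c b X t B ω ≠ ∅ := fun h0 => hB (by rw [h0, Finset.card_empty])
  rw [State.lcb, h.idx_eq_recorded, if_neg hne]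
  congr 1
  have hn : ((recorded α a₀ c b X t B ω).card : ℝ) ≠ 0 := by exact_mod_cast hB
  have h1 : (((recorded α a₀ c b X t B ω).card : ℝ)) ^ (-(1 / 2) : ℝ) =
      (√((recorded α a₀ c b X t B ω).card : ℝ))⁻¹ := by
    rw [Real.rpow_neg (by positivity), Real.sqrt_eq_rpow]
  rw [h1, centeredSum, Finset.sum_sub_distrib, Finset.sum_const, nsmul_eq_mul]
  field_simp
  ring

lemma abs_centeredSum_div_le {Ω : Type*} {b : ℕ → Ω → Bin d m} {X : ℕ → Ω → Fin d → ℝ}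
    {Y : ℕ → Ω → ℝ} {t : ℕ} {ω : Ω} (hω : ω ∉ deviationEvent α a₀ c f xs b X Y t)
    {B : Bin d m} (hB : (recorded α a₀ c b X t B ω).card ≠ 0) :
    |centeredSum α a₀ c f xs b X Y t B ω / (recorded α a₀ c b X t B ω).card| ≤
      (√((recorded α a₀ c b X t B ω).card : ℝ))⁻¹ * (Real.log t / 2) := by
  have h1 : |centeredSum α a₀ c f xs b X Y t B ω| ≤
      √((recorded α a₀ c b X t B ω).card : ℝ) * (Real.log t / 2) := by
    by_contra hlt
    exact hω ⟨B, hB, not_le.1 hlt⟩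
  have hn : (0 : ℝ) < (recorded α a₀ c b X t B ω).card := by
    exact_mod_cast Nat.pos_of_ne_zero hB
  have hs := Real.sqrt_pos.2 hn
  have hsq := Real.mul_self_sqrt hn.le
  rw [abs_div, abs_of_pos hn, div_le_iff₀ hn]
  refine h1.trans (le_of_eq ?_)
  generalize √((recorded α a₀ c b X t B ω).card : ℝ) = r at *
  rw [← hsq]
  field_simp

/-- Without deviations, a bin that is split has a small gap, provided that the bins that
contain the minimizer have lower confidence bounds below the minimum. -/
lemma gap_le_of_split (h : IsRun α a₀ μ c f P ℱ b U X W Y)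
    (hS : CostAssumption S A M C₀ α β f xs) (hc : InitialBins S A a₀ c)
    (hf : GapBounds a₀ c f xs M') (hμ : (2 : ℝ) ^ ((d : ℝ) + α) * M ≤ μ) (hμ0 : 0 ≤ μ) {t : ℕ}
    {ω : Ω} (hsplit : ω ∈ splitEvent α a₀ c b X t)
    (hω : ω ∉ deviationEvent α a₀ c f xs b X Y t)
    (hbig : ∀ B : Bin d m, A ≤ 2 * B.side a₀ → 2 * M' * √(B.capacity α : ℝ) ≤ Real.log t) :
    gap a₀ c f xs (b (t + 1) ω) ≤
      (μ * a₀ ^ α + 3 / 2 * Real.log t) * rate α (b (t + 1) ω).level := by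
  have ha₀ := hf.side_pos
  set B := b (t + 1) ω with hB_def
  set L := Real.log t with hL_def
  have hL : 0 ≤ L := Real.log_natCast_nonneg t
  have hcap : B.capacity α ≤ (recorded α a₀ c b X t B ω).card := (h.mem_splitEvent_iff t ω).1 hsplit
  have hB0 : (recorded α a₀ c b X t B ω).card ≠ 0 := by
    have := Bin.one_le_capacity α B; omega
  obtain ⟨j, hj⟩ := Set.mem_iUnion.1 (hc.cover hS.minimizer_mem)
  obtain ⟨B', hB', hxs⟩ := (h.invariant ω t).cover j xs hj
  have hmin := h.pick_min t ω B' hB'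
  rw [← hB_def, h.lcb_eq xs hB0] at hmin
  -- A bin without records has the bound ⊥ and would have been preferred to B, whose bound is
  -- finite.
  have hB'0 : (recorded α a₀ c b X t B' ω).card ≠ 0 := by
    intro h0
    rw [h.lcb_eq_bot h0, le_bot_iff] at hmin
    exact EReal.coe_ne_bot _ hmin
  rw [h.lcb_eq xs hB'0, EReal.coe_le_coe_iff] at hmin
  have h1 := (abs_le.1 (abs_centeredSum_div_le hω hB0)).1
  have h2 := (abs_le.1 (abs_centeredSum_div_le hω hB'0)).2
  have hs' := inv_sqrt_le_rate hcap
  have hcap' : (recorded α a₀ c b X t B' ω).card ≤ B'.capacity α := by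
    rw [← h.idx_eq_recorded]; exact (h.invariant ω t).card_le B'
  have hn' : (0 : ℝ) < (recorded α a₀ c b X t B' ω).card := by
    exact_mod_cast Nat.pos_of_ne_zero hB'0
  have hr' := Real.sqrt_pos.2 hn'
  rw [side_rpow ha₀, meanCost, meanCost] at hmin
  set r := (√((recorded α a₀ c b X t B ω).card : ℝ))⁻¹
  set r' := (√((recorded α a₀ c b X t B' ω).card : ℝ))⁻¹ with hr'_def
  have hr'0 : 0 < r' := inv_pos.2 hr'
  -- This puts the lower confidence bound of B' at or below f(x^*): the deviation uses half of the
  -- logarithmic term, the other half is available here. For large bins, where smoothness says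
  -- nothing, that half exceeds M' because few queries fit in such a bin.
  have hopt : gap a₀ c f xs B' ≤ μ * B'.side a₀ ^ α + r' * (L / 2) := by
    have hside : 0 < B'.side a₀ ^ α := Real.rpow_pos_of_pos (B'.side_pos ha₀) α
    by_cases hsm : 2 * B'.side a₀ < A
    · refine (hS.gap_le_of_mem hf hxs hsm).trans ?_
      have : 0 ≤ r' * (L / 2) := by positivity
      nlinarith
    · have hLb := hbig B' (not_lt.1 hsm)
      have hM' : 0 ≤ M' := (hf.gap_nonneg B').trans (hf.gap_le B')
      have hle : 2 * M' * √((recorded α a₀ c b X t B' ω).card : ℝ) ≤ L := by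
        refine le_trans ?_ hLb
        gcongr
      have h3 : M' ≤ r' * (L / 2) := by
        rw [hr'_def, inv_mul_eq_div, le_div_iff₀ hr']
        linarith
      have := hf.gap_le B'
      have : 0 ≤ μ * B'.side a₀ ^ α := by positivity
      linarith
  have h4 : r * (3 / 2 * L) ≤ rate α B.level * (3 / 2 * L) := by gcongr
  linarith

end IsRun

/-- Without deviations, a bin that is split has a small gap. -/
lemma exists_gap_le_of_split (d m : ℕ) {α A M a₀ μ : ℝ} (M' : ℝ) (hα : 0 ≤ α) (hA : 0 < A)
    (ha₀ : 0 < a₀) (hμ : (1 + (2 : ℝ) ^ ((d : ℝ) + α)) * M < μ) :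
    ∃ C₁ : ℝ, 0 < C₁ ∧ ∀ {β C₀ : ℝ} {S : Set (Fin d → ℝ)} {c : Fin m → Fin d → ℝ}
      {f : (Fin d → ℝ) → ℝ} {xs : Fin d → ℝ}
      {Ω : Type*} [mΩ : MeasurableSpace Ω] {P : Measure Ω}
      {ℱ : Filtration ℕ mΩ} {b : ℕ → Ω → Bin d m} {U X : ℕ → Ω → Fin d → ℝ} {W Y : ℕ → Ω → ℝ},
      CostAssumption S A M C₀ α β f xs → InitialBins S A a₀ c → GapBounds a₀ c f xs M' →
      IsRun α a₀ μ c f P ℱ b U X W Y →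
      ∀ (T t : ℕ) (ω : Ω), 2 ≤ T → t ≤ T → ω ∈ splitEvent α a₀ c b X t →
        ω ∉ deviationEvent α a₀ c f xs b X Y t →
        gap a₀ c f xs (b (t + 1) ω) ≤ C₁ * Real.log T * rate α (b (t + 1) ω).level := by
  -- From level k₀ on, bins are small enough for the smoothness assumption. The threshold `thr` for
  -- ln t serves the finitely many coarser levels.
  obtain ⟨k₀, hk₀⟩ : ∃ k₀ : ℕ, ∀ k, k₀ ≤ k → 2 * (a₀ / 2 ^ k) < A := by
    obtain ⟨k₀, hk₀⟩ := pow_unbounded_of_one_lt (2 * a₀ / A) one_lt_two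
    refine ⟨k₀, fun k hk => ?_⟩
    have h1 : 2 * a₀ / A < 2 ^ k := hk₀.trans_le (pow_le_pow_right₀ one_le_two hk)
    rw [div_lt_iff₀ hA] at h1
    rw [← mul_div_assoc, div_lt_iff₀ (by positivity)]
    linarith
  set thr : ℝ := 2 * |M'| * √((⌈(2 : ℝ) ^ (2 * α * (k₀ : ℝ))⌉₊ : ℕ) : ℝ) with hthr
  have hl2 : 0 < Real.log 2 := Real.log_pos one_lt_two
  -- Division by ln 2 turns constants into multiples of ln T. The absolute values keep C₁ positive
  -- before any cost function is given.
  refine ⟨(|μ| * a₀ ^ α + |M'| * Real.exp (thr / 2)) / Real.log 2 + 3 / 2, by positivity, ?_⟩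
  intro β C₀ S c f xs Ω mΩ P ℱ b U X W Y hS hc hf h T t ω hT ht hsplit hω
  have hM := hS.nonneg
  have hpow : 0 < (2 : ℝ) ^ ((d : ℝ) + α) := by positivity
  have hμ1 : (2 : ℝ) ^ ((d : ℝ) + α) * M ≤ μ := by nlinarith
  have hμ0 : 0 ≤ μ := le_trans (by positivity) hμ1
  have hM' : 0 ≤ M' := (hf.gap_nonneg (b (t + 1) ω)).trans (hf.gap_le _)
  have hlogT : Real.log 2 ≤ Real.log T := Real.log_le_log two_pos (by exact_mod_cast hT)
  have hr := rate_pos α (b (t + 1) ω).level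
  have hcap : (b (t + 1) ω).capacity α ≤ t :=
    ((h.mem_splitEvent_iff t ω).1 hsplit).trans (card_rounds_le _ _ _)
  have ht0 : (0 : ℝ) < t := by
    have := Bin.one_le_capacity α (b (t + 1) ω)
    exact_mod_cast (show 0 < t by omega)
  have hlogt : Real.log t ≤ Real.log T := Real.log_le_log ht0 (by exact_mod_cast ht)
  have hone : 1 ≤ Real.log T / Real.log 2 := (one_le_div hl2).2 hlogT
  have hμa : 0 ≤ μ * a₀ ^ α := by positivity
  have hMe : 0 ≤ M' * Real.exp (thr / 2) := by positivity
  have hlT : 0 ≤ Real.log T := hl2.le.trans hlogT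
  have hexpand : ((|μ| * a₀ ^ α + |M'| * Real.exp (thr / 2)) / Real.log 2 + 3 / 2) *
      Real.log T = (μ * a₀ ^ α) * (Real.log T / Real.log 2) +
        (M' * Real.exp (thr / 2)) * (Real.log T / Real.log 2) + 3 / 2 * Real.log T := by
    rw [abs_of_nonneg hμ0, abs_of_nonneg hM']; ring
  rw [hexpand]
  have e1 := mul_le_mul_of_nonneg_left hone hμa
  have e2 := mul_le_mul_of_nonneg_left hone hMe
  rw [mul_one] at e1 e2
  by_cases hcase : thr ≤ Real.log t
  · refine (h.gap_le_of_split hS hc hf hμ1 hμ0 hsplit hω ?_).trans ?_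
    · intro B hB
      have hlev : B.level ≤ k₀ := by
        by_contra hlt
        have := hk₀ B.level (not_le.1 hlt).le
        rw [Bin.side] at hB
        linarith
      have hcapB : B.capacity α ≤ ⌈(2 : ℝ) ^ (2 * α * (k₀ : ℝ))⌉₊ := by
        refine Nat.ceil_le_ceil ?_
        gcongr
        exact one_le_two
      refine le_trans ?_ hcase
      rw [hthr, abs_of_nonneg hM']
      gcongr
    · refine mul_le_mul_of_nonneg_right ?_ hr.le
      linarith
  -- For small t, the full bin has capacity at most t < exp(`thr`), so 2^{-αk} is bounded below and
  -- the trivial bound M' is enough.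
  · refine (hf.gap_le _).trans ?_
    have h1 : ((rate α (b (t + 1) ω).level)⁻¹) ^ 2 ≤ Real.exp (thr / 2) ^ 2 := by
      refine (inv_rate_sq_le_capacity α _).trans ?_
      calc (((b (t + 1) ω).capacity α : ℕ) : ℝ) ≤ t := by exact_mod_cast hcap
        _ = Real.exp (Real.log t) := (Real.exp_log ht0).symm
        _ ≤ Real.exp thr := Real.exp_le_exp.2 (not_le.1 hcase).le
        _ = Real.exp (thr / 2) ^ 2 := by rw [← Real.exp_nat_mul]; congr 1; push_cast; ring
    have h2 : (rate α (b (t + 1) ω).level)⁻¹ ≤ Real.exp (thr / 2) :=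
      le_of_sq_le_sq h1 (Real.exp_pos _).le
    have h3 : 1 ≤ Real.exp (thr / 2) * rate α (b (t + 1) ω).level :=
      (inv_le_iff_one_le_mul₀ hr).1 h2
    calc M' ≤ M' * (Real.exp (thr / 2) * rate α (b (t + 1) ω).level) :=
          le_mul_of_one_le_right hM' h3
      _ = M' * Real.exp (thr / 2) * rate α (b (t + 1) ω).level := by ring
      _ ≤ _ := mul_le_mul_of_nonneg_right (by linarith) hr.le

end SplitGap

/-! ### Decomposition of the regret -/

section Regret

variable {d m : ℕ} {α β A M C₀ a₀ μ : ℝ} {S : Set (Fin d → ℝ)} {c : Fin m → Fin d → ℝ}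
  {f : (Fin d → ℝ) → ℝ} {xs : Fin d → ℝ} {M' : ℝ}

lemma card_filter_range_eq (r : ℕ → Bin d m) (T : ℕ) (B : Bin d m) :
    ((Finset.range T).filter (fun t => r (t + 1) = B)).card = (rounds r T B).card := by
  induction T with
  | zero => simp [rounds_zero]
  | succ T ih =>
    rw [Finset.range_add_one, Finset.filter_insert, card_rounds_succ, ← ih]
    split_ifs with hB
    · rw [Finset.card_insert_of_notMem (by simp)]
    · rfl

lemma card_children_le (B : Bin d m) : B.children.card ≤ 2 ^ d :=
  Finset.card_image_le.trans (by simp)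

lemma rate_le_one (hα : 0 ≤ α) (k : ℕ) : rate α k ≤ 1 :=
  Real.rpow_le_one_of_one_le_of_nonpos one_le_two (by have : 0 ≤ α * k := by positivity
                                                      linarith)

lemma rate_antitone (hα : 0 ≤ α) {k l : ℕ} (hkl : k ≤ l) : rate α l ≤ rate α k := by
  refine Real.rpow_le_rpow_of_exponent_le one_le_two (neg_le_neg ?_)
  gcongr

/-- One level multiplies 2^{2αk} by 2^{2α} ≤ 16; the 1 is for rounding up. -/
lemma capacity_child_le (hα : α ≤ 2) (B : Bin d m) (l : Fin d → Bool) :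
    ((B.child l).capacity α : ℝ) ≤ 16 * ((rate α B.level)⁻¹) ^ 2 + 1 := by
  have h1 : (2 : ℝ) ^ (2 * α * (((B.child l).level : ℕ) : ℝ)) ≤ 16 * ((rate α B.level)⁻¹) ^ 2 := by
    rw [← two_rpow_eq_inv_rate_sq, Bin.level_child]
    have : (2 : ℝ) ^ (2 * α) ≤ 16 := by
      calc (2 : ℝ) ^ (2 * α) ≤ 2 ^ (4 : ℝ) :=
            Real.rpow_le_rpow_of_exponent_le one_le_two (by linarith)
        _ = 16 := by norm_num
    calc (2 : ℝ) ^ (2 * α * ((B.level + 1 : ℕ) : ℝ))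
        = 2 ^ (2 * α) * 2 ^ (2 * α * (B.level : ℝ)) := by
          rw [← Real.rpow_add two_pos]; congr 1; push_cast; ring
      _ ≤ _ := by gcongr
  exact (Nat.ceil_lt_add_one (by positivity)).le.trans (by linarith)

/-- The bound for the number of bins of level `k` whose gap is at most `E 2^{-αk}`. -/
noncomputable def binCount (d m : ℕ) (α β C₀ a₀ E : ℝ) (k : ℕ) : ℝ :=
  m * (2 ^ d + 1) * (C₀ * (1 + (2 * (E * rate α k)) ^ β / (a₀ / 2 ^ k) ^ d))

variable {Ω : Type*} [mΩ : MeasurableSpace Ω] {P : Measure Ω}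
  {ℱ : Filtration ℕ mΩ} {b : ℕ → Ω → Bin d m} {U X : ℕ → Ω → Fin d → ℝ} {W Y : ℕ → Ω → ℝ}

namespace IsRun

lemma card_picks_le (h : IsRun α a₀ μ c f P ℱ b U X W Y) (ω : Ω) (T : ℕ) (F : Finset (Bin d m)) :
    ((Finset.range T).filter (fun t => b (t + 1) ω ∈ F)).card ≤
      ∑ B ∈ F, (B.capacity α + 1) := by
  have hsub : (Finset.range T).filter (fun t => b (t + 1) ω ∈ F) ⊆
      F.biUnion fun B => (Finset.range T).filter (fun t => b (t + 1) ω = B) := by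
    intro t ht
    rw [Finset.mem_filter] at ht
    exact Finset.mem_biUnion.2 ⟨_, ht.2, Finset.mem_filter.2 ⟨ht.1, rfl⟩⟩
  refine (Finset.card_le_card hsub).trans (Finset.card_biUnion_le.trans ?_)
  refine Finset.sum_le_sum fun B _ => ?_
  rw [card_filter_range_eq (fun s => b s ω)]
  exact (h.invariant ω T).picks_le B

/-- Initial bins have capacity 1 and are picked once more to be split. -/
lemma card_picks_root_le (h : IsRun α a₀ μ c f P ℱ b U X W Y) (ω : Ω) (T : ℕ) :
    ((Finset.range T).filter (fun t => (b (t + 1) ω).2 = [])).card ≤ 2 * m := by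
  have hsub : (Finset.range T).filter (fun t => (b (t + 1) ω).2 = []) ⊆
      (Finset.range T).filter (fun t => b (t + 1) ω ∈
        Finset.univ.image (fun j : Fin m => ((j, []) : Bin d m))) := by
    intro t ht
    rw [Finset.mem_filter] at ht ⊢
    exact ⟨ht.1, Finset.mem_image.2 ⟨(b (t + 1) ω).1, Finset.mem_univ _, Prod.ext rfl ht.2.symm⟩⟩
  refine (Finset.card_le_card hsub).trans ((h.card_picks_le ω T _).trans ?_)
  have hcap : ∀ B ∈ Finset.univ.image (fun j : Fin m => ((j, []) : Bin d m)),
      Bin.capacity α B + 1 ≤ 2 := by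
    intro B hB
    obtain ⟨j, -, rfl⟩ := Finset.mem_image.1 hB
    simp [Bin.capacity, Bin.level]
  refine (Finset.sum_le_card_nsmul _ _ 2 hcap).trans ?_
  have : (Finset.univ.image (fun j : Fin m => ((j, []) : Bin d m))).card ≤ m :=
    Finset.card_image_le.trans (by simp)
  rw [smul_eq_mul]
  omega

lemma card_picks_children_le (h : IsRun α a₀ μ c f P ℱ b U X W Y)
    (hα : α ≤ 2) (ω : Ω) (T : ℕ) (B : Bin d m) :
    (((Finset.range T).filter (fun t => b (t + 1) ω ∈ B.children)).card : ℝ) ≤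
      2 ^ d * (16 * ((rate α B.level)⁻¹) ^ 2 + 2) := by
  have h1 : (((Finset.range T).filter (fun t => b (t + 1) ω ∈ B.children)).card : ℝ) ≤
      ∑ B' ∈ B.children, ((B'.capacity α : ℝ) + 1) := by
    exact_mod_cast h.card_picks_le ω T B.children
  refine h1.trans ((Finset.sum_le_card_nsmul _ _ (16 * ((rate α B.level)⁻¹) ^ 2 + 2) ?_).trans ?_)
  · intro B' hB'
    obtain ⟨l, rfl⟩ := Bin.mem_children.1 hB'
    linarith [capacity_child_le hα B l]
  · rw [nsmul_eq_mul]
    gcongr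
    exact_mod_cast card_children_le B

-- The packing count of the possible parents times the number of picks of the children of each. The
-- constant 18 is 16 + 2, as the rate is at most 1.
open Classical in
lemma card_picks_level_le (h : IsRun α a₀ μ c f P ℱ b U X W Y)
    (hα0 : 0 ≤ α) (hα : α ≤ 2) (hS : CostAssumption S A M C₀ α β f xs)
    (hA : 0 < A) (hc : InitialBins S A a₀ c) (hf : GapBounds a₀ c f xs M') {E : ℝ} (hE : 0 < E)
    (ω : Ω) (T k : ℕ) :
    (((Finset.range T).filter (fun t => ∃ B : Bin d m, B.level = k ∧
      gap a₀ c f xs B ≤ E * rate α k ∧ b (t + 1) ω ∈ B.children)).card : ℝ) ≤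
      binCount d m α β C₀ a₀ E k * (2 ^ d * (18 * ((rate α k)⁻¹) ^ 2)) := by
  have hr := rate_pos α k
  have hne : Nonempty (Bin d m) := ⟨b 0 ω⟩
  set Q := (Finset.range T).filter (fun t => ∃ B : Bin d m, B.level = k ∧
      gap a₀ c f xs B ≤ E * rate α k ∧ b (t + 1) ω ∈ B.children) with hQ
  choose! p hp using fun t (ht : t ∈ Q) => (Finset.mem_filter.1 ht).2
  have hG := hS.card_bins_le hA hc hf (ε := E * rate α k) (by positivity) k (Q.image p)
    (by intro B hB; obtain ⟨t, ht, rfl⟩ := Finset.mem_image.1 hB; exact (hp t ht).1)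
    (by intro B hB; obtain ⟨t, ht, rfl⟩ := Finset.mem_image.1 hB; exact (hp t ht).2.1)
  have hsub : Q ⊆ (Q.image p).biUnion fun B =>
      (Finset.range T).filter (fun t => b (t + 1) ω ∈ B.children) := by
    intro t ht
    exact Finset.mem_biUnion.2 ⟨p t, Finset.mem_image_of_mem _ ht,
      Finset.mem_filter.2 ⟨(Finset.mem_filter.1 ht).1, (hp t ht).2.2⟩⟩
  have h1 : (Q.card : ℝ) ≤ ∑ B ∈ Q.image p,
      (((Finset.range T).filter (fun t => b (t + 1) ω ∈ B.children)).card : ℝ) := by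
    exact_mod_cast (Finset.card_le_card hsub).trans Finset.card_biUnion_le
  refine h1.trans ((Finset.sum_le_card_nsmul _ _ (2 ^ d * (18 * ((rate α k)⁻¹) ^ 2)) ?_).trans ?_)
  · intro B hB
    obtain ⟨t, ht, rfl⟩ := Finset.mem_image.1 hB
    refine (h.card_picks_children_le hα ω T _).trans ?_
    rw [(hp t ht).1]
    have : 1 ≤ ((rate α k)⁻¹) ^ 2 := one_le_pow₀ ((one_le_inv₀ hr).2 (rate_le_one hα0 k))
    gcongr
    linarith
  · rw [nsmul_eq_mul]
    exact mul_le_mul_of_nonneg_right hG (by positivity)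

/-- The sum of the gaps of the picked bins. -/
lemma sum_gap_le (h : IsRun α a₀ μ c f P ℱ b U X W Y)
    (hα0 : 0 ≤ α) (hα : α ≤ 2) (hS : CostAssumption S A M C₀ α β f xs) (hA : 0 < A)
    (hc : InitialBins S A a₀ c) (hf : GapBounds a₀ c f xs M') {E : ℝ} (hE : 0 < E) (ω : Ω)
    (T K : ℕ) (hgood : ∀ t ≤ T, ω ∈ splitEvent α a₀ c b X t →
      ω ∉ deviationEvent α a₀ c f xs b X Y t →
        gap a₀ c f xs (b (t + 1) ω) ≤ E * rate α (b (t + 1) ω).level) :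
    ∑ t ∈ Finset.range T, gap a₀ c f xs (b (t + 1) ω) ≤
      2 * m * M' +
      ∑ k ∈ Finset.range K, binCount d m α β C₀ a₀ E k * (2 ^ d * (18 * ((rate α k)⁻¹) ^ 2)) *
        (2 ^ d * (E * rate α k)) +
      T * (2 ^ d * (E * rate α K)) +
      ∑ s ∈ Finset.range T, (deviationEvent α a₀ c f xs b X Y s).indicator
        (fun _ => 2 ^ d * (16 * (s : ℝ) + 2) * M') ω := by
  classical
  have hM' : 0 ≤ M' := (hf.gap_nonneg (b 0 ω)).trans (hf.gap_le _)
  set good : ℕ → ℕ → Prop := fun k t => ∃ B : Bin d m, B.level = k ∧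
    gap a₀ c f xs B ≤ E * rate α k ∧ b (t + 1) ω ∈ B.children with hgood_def
  set bad : ℕ → ℕ → Prop := fun s t => ω ∈ deviationEvent α a₀ c f xs b X Y s ∧
    ω ∈ splitEvent α a₀ c b X s ∧ b (t + 1) ω ∈ (b (s + 1) ω).children with hbad_def
  -- The four terms: initial bins; children of split bins of level below K with the good gap bound;
  -- the same from level K on, bounded uniformly; children of bins that were split under a
  -- deviation.
  have hpt : ∀ t ∈ Finset.range T, gap a₀ c f xs (b (t + 1) ω) ≤
      (if (b (t + 1) ω).2 = [] then M' else 0) +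
      ∑ k ∈ Finset.range K, (if good k t then 2 ^ d * (E * rate α k) else 0) +
      2 ^ d * (E * rate α K) +
      ∑ s ∈ Finset.range T, (if bad s t then M' else 0) := by
    intro t ht
    have hnn1 : 0 ≤ (if (b (t + 1) ω).2 = [] then M' else 0) := by split_ifs <;> simp [hM']
    have hnn2 : ∀ k ∈ Finset.range K,
        0 ≤ (if good k t then 2 ^ d * (E * rate α k) else 0) := by
      intro k _
      have := rate_pos α k
      split_ifs <;> positivity
    have hnn3 : 0 ≤ 2 ^ d * (E * rate α K) := by have := rate_pos α K; positivity
    have hnn4 : ∀ s ∈ Finset.range T, 0 ≤ (if bad s t then M' else 0) := by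
      intro s _; split_ifs <;> simp [hM']
    have hs2 := Finset.sum_nonneg hnn2
    have hs4 := Finset.sum_nonneg hnn4
    rcases (h.invariant ω t).parent _ (h.pick_mem t ω) with h0 | ⟨s, hst, hsplit, l, hl⟩
    · have := hf.gap_le (b (t + 1) ω)
      rw [if_pos h0]
      linarith
    · have hsT : s < T := hst.trans (Finset.mem_range.1 ht)
      have hmem : b (t + 1) ω ∈ (b (s + 1) ω).children := Bin.mem_children.2 ⟨l, hl.symm⟩
      by_cases hdev : ω ∈ deviationEvent α a₀ c f xs b X Y s
      · have h1 := Finset.single_le_sum hnn4 (Finset.mem_range.2 hsT)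
        rw [if_pos ⟨hdev, hsplit, hmem⟩] at h1
        have := hf.gap_le (b (t + 1) ω)
        linarith
      · have hg := hgood s hsT.le hsplit hdev
        have hch : gap a₀ c f xs (b (t + 1) ω) ≤ 2 ^ d * (E * rate α (b (s + 1) ω).level) := by
          have h2 := hf.gap_child_le (b (s + 1) ω) l
          rw [← hl] at h2
          refine h2.trans ?_
          gcongr
        by_cases hk : (b (s + 1) ω).level < K
        · have h1 := Finset.single_le_sum hnn2 (Finset.mem_range.2 hk)
          rw [if_pos ⟨_, rfl, hg, hmem⟩] at h1
          linarith
        · have h1 : 2 ^ d * (E * rate α (b (s + 1) ω).level) ≤ 2 ^ d * (E * rate α K) := by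
            gcongr
            exact rate_antitone hα0 (not_lt.1 hk)
          linarith
  refine (Finset.sum_le_sum hpt).trans ?_
  rw [Finset.sum_add_distrib, Finset.sum_add_distrib, Finset.sum_add_distrib]
  refine add_le_add (add_le_add (add_le_add ?_ ?_) ?_) ?_
  · rw [← Finset.sum_filter, Finset.sum_const, nsmul_eq_mul]
    gcongr
    exact_mod_cast h.card_picks_root_le ω T
  · rw [Finset.sum_comm]
    refine Finset.sum_le_sum fun k _ => ?_
    rw [← Finset.sum_filter, Finset.sum_const, nsmul_eq_mul]
    have := rate_pos α k
    exact mul_le_mul_of_nonneg_right (h.card_picks_level_le hα0 hα hS hA hc hf hE ω T k)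
      (by positivity)
  · rw [Finset.sum_const, Finset.card_range, nsmul_eq_mul]
  · rw [Finset.sum_comm]
    refine Finset.sum_le_sum fun s _ => ?_
    rw [← Finset.sum_filter, Finset.sum_const, nsmul_eq_mul]
    by_cases hs : ω ∈ deviationEvent α a₀ c f xs b X Y s ∧ ω ∈ splitEvent α a₀ c b X s
    · rw [Set.indicator_of_mem hs.1]
      refine mul_le_mul_of_nonneg_right ?_ hM'
      -- A bin split in round s + 1 is full of earlier records. Hence the picks of its children
      -- number O(s), however late they happen.
      have hcap : ((b (s + 1) ω).capacity α : ℝ) ≤ s := by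
        exact_mod_cast ((h.mem_splitEvent_iff s ω).1 hs.2).trans (card_rounds_le _ _ _)
      have h1 := inv_rate_sq_le_capacity α (b (s + 1) ω)
      have h2 := h.card_picks_children_le hα ω T (b (s + 1) ω)
      have h3 : (((Finset.range T).filter (bad s)).card : ℝ) ≤
          (((Finset.range T).filter (fun t => b (t + 1) ω ∈ (b (s + 1) ω).children)).card : ℝ) := by
        exact_mod_cast Finset.card_le_card
          (Finset.monotone_filter_right _ fun t _ (ht : bad s t) => ht.2.2)
      refine h3.trans (h2.trans ?_)
      gcongr
      linarith
    · have : (Finset.range T).filter (bad s) = ∅ :=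
        Finset.filter_eq_empty_iff.2 fun t _ (ht : bad s t) => hs ⟨ht.1, ht.2.1⟩
      rw [this, Finset.card_empty, Nat.cast_zero, zero_mul]
      exact Set.indicator_nonneg (fun _ _ => by positivity) _

/-! ### Expectations -/

lemma measurable_gap_pick (h : IsRun α a₀ μ c f P ℱ b U X W Y)
    (t : ℕ) : Measurable (fun ω => gap a₀ c f xs (b (t + 1) ω)) :=
  measurable_of_countable_fibers (fun k => ℱ.le t _ (h.pick_measurable t k))
    (F := fun B _ => gap a₀ c f xs B) fun _ => measurable_const

lemma integrable_gap_pick (h : IsRun α a₀ μ c f P ℱ b U X W Y)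
    [IsProbabilityMeasure P] (hf : GapBounds a₀ c f xs M') (t : ℕ) :
    Integrable (fun ω => gap a₀ c f xs (b (t + 1) ω)) P :=
  Integrable.of_mem_Icc 0 M' (h.measurable_gap_pick t).aemeasurable
    (ae_of_all _ fun _ => ⟨hf.gap_nonneg _, hf.gap_le _⟩)

lemma ae_gap_query_mem (h : IsRun α a₀ μ c f P ℱ b U X W Y) (hf : GapBounds a₀ c f xs M') (t : ℕ) :
    ∀ᵐ ω ∂P, f (X (t + 1) ω) - f xs ∈ Set.Icc 0 M' := by
  have hU : Measurable (U (t + 1)) := (h.unif_measurable t).mono (ℱ.le _) le_rfl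
  have h1 : ∀ᵐ u ∂(P.map (U (t + 1))), u ∈ Set.Icc (0 : Fin d → ℝ) 1 := by
    rw [h.unif_law]; exact ae_unif_mem
  filter_upwards [ae_of_ae_map hU.aemeasurable h1] with ω hω
  have hx := (b (t + 1) ω).point_mem_region (c := c) hf.side_pos hω
  rw [← h.query_eq_point] at hx
  exact ⟨sub_nonneg.2 (hf.le _ _ hx), hf.sub_le _ _ hx⟩

lemma measurable_gap_query (h : IsRun α a₀ μ c f P ℱ b U X W Y) (hf : Measurable f) (t : ℕ) :
    Measurable (fun ω => f (X (t + 1) ω) - f xs) :=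
  (hf.comp ((h.measurable_query t).mono (ℱ.le _) le_rfl)).sub_const _

lemma integrable_gap_query (h : IsRun α a₀ μ c f P ℱ b U X W Y)
    [IsProbabilityMeasure P] (hf : GapBounds a₀ c f xs M') (t : ℕ) :
    Integrable (fun ω => f (X (t + 1) ω) - f xs) P :=
  Integrable.of_mem_Icc 0 M' (h.measurable_gap_query hf.measurable t).aemeasurable
    (h.ae_gap_query_mem hf t)

/-- The picked bin is determined by the past, and the fresh uniform point is independent of it. -/
lemma integral_gap_query (h : IsRun α a₀ μ c f P ℱ b U X W Y)
    [IsProbabilityMeasure P] (hf : GapBounds a₀ c f xs M') (t : ℕ) :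
    ∫ ω, (f (X (t + 1) ω) - f xs) ∂P = ∫ ω, gap a₀ c f xs (b (t + 1) ω) ∂P := by
  rw [integral_eq_lintegral_of_nonneg_ae ((h.ae_gap_query_mem hf t).mono fun _ hx => hx.1)
      (h.measurable_gap_query hf.measurable t).aestronglyMeasurable,
    integral_eq_lintegral_of_nonneg_ae (ae_of_all _ fun _ => hf.gap_nonneg _)
      (h.measurable_gap_pick t).aestronglyMeasurable]
  congr 1
  have hg : ∀ B : Bin d m, Measurable
      (fun p : (Fin d → ℝ) × ℝ => ENNReal.ofReal (f (B.point a₀ c p.1) - f xs)) := fun B =>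
    ((hf.measurable_gap_point B).comp measurable_fst).ennreal_ofReal
  have hfresh := h.lintegral_fresh (h.pick_measurable t) (H := fun _ => 1) measurable_const hg
  simp only [one_mul, ← h.query_eq_point] at hfresh
  rw [hfresh]
  refine lintegral_congr fun ω => ?_
  rw [lintegral_prod _ (hg _).aemeasurable]
  simp only [lintegral_const, measure_univ, mul_one]
  rw [gap, ofReal_integral_eq_lintegral_ofReal (hf.integrable _)
    ((hf.ae_mem _).mono fun _ hx => hx.1)]

lemma cumRegret_eq (x : ℕ → Fin d → ℝ) (T : ℕ) :
    cumRegret f xs x T = ∑ t ∈ Finset.range T, (f (x (t + 1)) - f xs) := by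
  induction T with
  | zero => simp [cumRegret]
  | succ T ih =>
    rw [Finset.sum_range_succ, ← ih, cumRegret, Finset.sum_Icc_succ_top (by omega)]
    rfl

lemma integrable_cumRegret (h : IsRun α a₀ μ c f P ℱ b U X W Y)
    [IsProbabilityMeasure P] (hf : GapBounds a₀ c f xs M') (T : ℕ) :
    Integrable (fun ω => cumRegret f xs (fun t => X t ω) T) P := by
  simp only [cumRegret_eq]
  exact integrable_finsetSum _ fun t _ => h.integrable_gap_query hf t

lemma integral_cumRegret_eq (h : IsRun α a₀ μ c f P ℱ b U X W Y)
    [IsProbabilityMeasure P] (hf : GapBounds a₀ c f xs M') (T : ℕ) :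
    ∫ ω, cumRegret f xs (fun t => X t ω) T ∂P =
      ∫ ω, ∑ t ∈ Finset.range T, gap a₀ c f xs (b (t + 1) ω) ∂P := by
  simp only [cumRegret_eq]
  rw [integral_finsetSum _ fun t _ => h.integrable_gap_query hf t,
    integral_finsetSum _ fun t _ => h.integrable_gap_pick hf t]
  exact Finset.sum_congr rfl fun t _ => h.integral_gap_query hf t

lemma measure_deviationEvent_mul_le (h : IsRun α a₀ μ c f P ℱ b U X W Y)
    [IsProbabilityMeasure P] (hf : GapBounds a₀ c f xs M')
    (s : ℕ) : P.real (deviationEvent α a₀ c f xs b X Y s) * (16 * s + 2) ≤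
      36 * Real.exp (50 * varProxy M') * (1 / (s : ℝ) ^ 2) := by
  -- At s = 0 nothing is recorded and the event is empty, which matches the value 1 / 0 = 0 on the
  -- right.
  rcases Nat.eq_zero_or_pos s with rfl | hs
  · have : deviationEvent α a₀ c f xs b X Y 0 = ∅ := by
      ext ω
      simp [deviationEvent, recorded, rounds_zero]
    simp [this]
  · have hs' : (1 : ℝ) ≤ s := by exact_mod_cast hs
    have h1 : P.real (deviationEvent α a₀ c f xs b X Y s) ≤
        2 * Real.exp (50 * varProxy M') / (s : ℝ) ^ 3 := by
      rw [Measure.real]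
      exact ENNReal.toReal_le_of_le_ofReal (by positivity) (h.measure_deviationEvent_le hf hs)
    calc _ ≤ 2 * Real.exp (50 * varProxy M') / (s : ℝ) ^ 3 * (18 * s) := by
          gcongr
          linarith
      _ = _ := by field_simp; ring

/-- The regret bound with the number `K` of resolved levels as a parameter. -/
lemma integral_cumRegret_le (h : IsRun α a₀ μ c f P ℱ b U X W Y)
    [IsProbabilityMeasure P] (hα0 : 0 ≤ α) (hα : α ≤ 2)
    (hS : CostAssumption S A M C₀ α β f xs) (hA : 0 < A)
    (hc : InitialBins S A a₀ c) (hf : GapBounds a₀ c f xs M') {E : ℝ} (hE : 0 < E)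
    (T K : ℕ) (hgood : ∀ ω, ∀ t ≤ T, ω ∈ splitEvent α a₀ c b X t →
      ω ∉ deviationEvent α a₀ c f xs b X Y t →
        gap a₀ c f xs (b (t + 1) ω) ≤ E * rate α (b (t + 1) ω).level) :
    ∫ ω, cumRegret f xs (fun t => X t ω) T ∂P ≤
      2 * m * M' +
      ∑ k ∈ Finset.range K, binCount d m α β C₀ a₀ E k * (2 ^ d * (18 * ((rate α k)⁻¹) ^ 2)) *
        (2 ^ d * (E * rate α k)) +
      T * (2 ^ d * (E * rate α K)) +
      2 ^ d * M' * (36 * Real.exp (50 * varProxy M') * ∑' s : ℕ, 1 / (s : ℝ) ^ 2) := by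
  have hne : Nonempty Ω := nonempty_of_isProbabilityMeasure P
  have hM' : 0 ≤ M' := (hf.gap_nonneg (b 0 hne.some)).trans (hf.gap_le _)
  rw [h.integral_cumRegret_eq hf]
  set D : ℝ := 2 * m * M' +
      ∑ k ∈ Finset.range K, binCount d m α β C₀ a₀ E k * (2 ^ d * (18 * ((rate α k)⁻¹) ^ 2)) *
        (2 ^ d * (E * rate α k)) + T * (2 ^ d * (E * rate α K)) with hD
  have hmeas := fun s => h.measurableSet_deviationEvent (xs := xs) hf.measurable s
  have hint : ∀ s ∈ Finset.range T, Integrable ((deviationEvent α a₀ c f xs b X Y s).indicator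
        (fun _ => 2 ^ d * (16 * (s : ℝ) + 2) * M')) P :=
    fun s _ => (integrable_const _).indicator (hmeas s)
  calc ∫ ω, ∑ t ∈ Finset.range T, gap a₀ c f xs (b (t + 1) ω) ∂P
      ≤ ∫ ω, (D + ∑ s ∈ Finset.range T, (deviationEvent α a₀ c f xs b X Y s).indicator
        (fun _ => 2 ^ d * (16 * (s : ℝ) + 2) * M') ω) ∂P :=
        integral_mono (integrable_finsetSum _ fun t _ => h.integrable_gap_pick hf t)
          ((integrable_const D).add (integrable_finsetSum _ hint))
          fun ω => h.sum_gap_le hα0 hα hS hA hc hf hE ω T K (hgood ω)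
    _ = D + ∑ s ∈ Finset.range T, P.real (deviationEvent α a₀ c f xs b X Y s) *
          (2 ^ d * (16 * (s : ℝ) + 2) * M') := by
        rw [integral_add (integrable_const D) (integrable_finsetSum _ hint),
          integral_finsetSum _ hint]
        simp [integral_indicator_const _ (hmeas _)]
    _ ≤ D + ∑ s ∈ Finset.range T, 2 ^ d * M' *
          (36 * Real.exp (50 * varProxy M') * (1 / (s : ℝ) ^ 2)) := by
        refine add_le_add le_rfl (Finset.sum_le_sum fun s _ => ?_)
        calc _ = 2 ^ d * M' * (P.real (deviationEvent α a₀ c f xs b X Y s) * (16 * s + 2)) := by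
              ring
          _ ≤ _ := mul_le_mul_of_nonneg_left (h.measure_deviationEvent_mul_le hf s)
              (by positivity)
    _ ≤ _ := by
        rw [← Finset.mul_sum, ← Finset.mul_sum]
        gcongr
        exact Summable.sum_le_tsum _ (fun s _ => by positivity)
          (Real.summable_one_div_nat_pow.2 one_lt_two)

end IsRun

end Regret

/-! ### The choice of the number of resolved levels -/

section Assembly

variable {d m : ℕ} {α β A M C₀ a₀ μ : ℝ} {S : Set (Fin d → ℝ)} {c : Fin m → Fin d → ℝ}
  {f : (Fin d → ℝ) → ℝ} {xs : Fin d → ℝ} {M' : ℝ}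

lemma gapBounds_of_initialBins (ha₀ : 0 < a₀) (hS : CostAssumption S A M C₀ α β f xs)
    (hc : InitialBins S A a₀ c)
    (hM' : ∀ j : Fin m, ∀ x ∈ Bin.region a₀ c ((j, []) : Bin d m), f x - f xs ≤ M') :
    GapBounds a₀ c f xs M' where
  side_pos := ha₀
  measurable := hS.measurable
  le B x hx := hS.minimizer_le x (hc.subset_domain B.1 (Bin.region_subset_root ha₀ B hx))
  sub_le B x hx := hM' B.1 x (Bin.region_subset_root ha₀ B hx)

/-- The regret of the rounds in bins that are children of bins of level `k`. -/
lemma level_term_le (d m : ℕ) {α β C₀ a₀ C₁ L : ℝ} (hβ : 0 ≤ β)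
    (hαβ : α * β ≤ d) (hC₀ : 0 < C₀) (ha₀ : 0 < a₀) (hC₁ : 0 < C₁) (hL : Real.log 2 ≤ L) (k : ℕ) :
    binCount d m α β C₀ a₀ (C₁ * L) k * (2 ^ d * (18 * ((rate α k)⁻¹) ^ 2)) *
        (2 ^ d * (C₁ * L * rate α k)) ≤
      m * (2 ^ d + 1) * C₀ * (18 * 4 ^ d) * C₁ *
        ((Real.log 2 ^ β)⁻¹ + (2 * C₁) ^ β / a₀ ^ d) * L ^ (β + 1) *
          ((2 : ℝ) ^ ((d : ℝ) + α - α * β)) ^ k := by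
  have hl2 : 0 < Real.log 2 := Real.log_pos one_lt_two
  have hL0 : 0 < L := hl2.trans_le hL
  have hr := rate_pos α k
  set q : ℝ := (d : ℝ) + α - α * β with hq
  -- The constant term of the packing bound contributes 2^{αk}. Since αβ ≤ d, it does not exceed the
  -- growth 2^{qk} of the main term.
  have h1 : (rate α k)⁻¹ ≤ ((2 : ℝ) ^ q) ^ k := by
    rw [rate, ← Real.rpow_neg two_pos.le, neg_neg, ← Real.rpow_natCast, ← Real.rpow_mul two_pos.le]
    refine Real.rpow_le_rpow_of_exponent_le one_le_two ?_
    gcongr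
    linarith
  have h2 : (rate α k)⁻¹ * (rate α k ^ β / (a₀ / 2 ^ k) ^ d) = ((2 : ℝ) ^ q) ^ k / a₀ ^ d := by
    have e1 : (rate α k)⁻¹ * rate α k ^ β * (2 ^ k) ^ d = ((2 : ℝ) ^ q) ^ k := by
      rw [rate, ← Real.rpow_neg two_pos.le, ← Real.rpow_mul two_pos.le, ← Real.rpow_add two_pos,
        ← Real.rpow_natCast 2 k, ← Real.rpow_natCast _ d, ← Real.rpow_mul two_pos.le,
        ← Real.rpow_add two_pos, ← Real.rpow_natCast _ k, ← Real.rpow_mul two_pos.le]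
      congr 1
      rw [hq]
      ring
    rw [← e1, div_pow]
    field_simp
  have h3 : (2 * (C₁ * L * rate α k)) ^ β = (2 * C₁) ^ β * L ^ β * rate α k ^ β := by
    rw [← Real.mul_rpow (by positivity) (by positivity),
      ← Real.mul_rpow (by positivity) (by positivity)]
    congr 1; ring
  have h4 : 1 ≤ (Real.log 2 ^ β)⁻¹ * L ^ β := by
    rw [inv_mul_eq_div, one_le_div (by positivity)]
    exact Real.rpow_le_rpow hl2.le hL hβ
  have h5 : (4 : ℝ) ^ d = 2 ^ d * 2 ^ d := by rw [← mul_pow]; norm_num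
  have h6 : L ^ (β + 1) = L ^ β * L := Real.rpow_add_one hL0.ne' β
  set K₁ : ℝ := m * (2 ^ d + 1) * C₀ * (18 * 4 ^ d) * C₁ with hK₁
  have hK₁0 : 0 ≤ K₁ := by positivity
  calc _ = K₁ * L * ((rate α k)⁻¹ + (2 * C₁) ^ β * L ^ β *
        ((rate α k)⁻¹ * (rate α k ^ β / (a₀ / 2 ^ k) ^ d))) := by
        rw [binCount, h3, hK₁, h5]
        field_simp
    _ = K₁ * L * ((rate α k)⁻¹ * 1 + (2 * C₁) ^ β * L ^ β * (((2 : ℝ) ^ q) ^ k / a₀ ^ d)) := by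
        rw [h2, mul_one]
    _ ≤ K₁ * L * (((2 : ℝ) ^ q) ^ k * ((Real.log 2 ^ β)⁻¹ * L ^ β) +
          (2 * C₁) ^ β * L ^ β * (((2 : ℝ) ^ q) ^ k / a₀ ^ d)) := by
        gcongr
    _ = _ := by rw [h6]; ring

/-- The regret bound as a function of the horizon. -/
lemma exists_horizon_bound {d : ℕ} {α β : ℝ} (hα : 0 < α) (hβ : 0 ≤ β) (hαβ : α * β ≤ d)
    (R₀ R₁ R₂ : ℝ) (hR₀ : 0 ≤ R₀) (hR₁ : 0 ≤ R₁) (hR₂ : 0 ≤ R₂) :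
    ∃ C : ℝ, ∀ T : ℕ, 2 ≤ T → ∃ K : ℕ,
      R₀ + R₁ * Real.log T ^ (β + 1) *
          ∑ k ∈ Finset.range K, ((2 : ℝ) ^ ((d : ℝ) + α - α * β)) ^ k +
        T * (R₂ * Real.log T * rate α K) ≤
      T * (C * (T : ℝ) ^ (-(α / ((d : ℝ) + 2 * α - α * β))) * Real.log T ^ (β + 1)) := by
  have hl2 : 0 < Real.log 2 := Real.log_pos one_lt_two
  set q : ℝ := (d : ℝ) + α - α * β with hq
  have hqα : α ≤ q := by linarith
  have hD : (d : ℝ) + 2 * α - α * β = q + α := by rw [hq]; ring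
  have h2q : 1 < (2 : ℝ) ^ q := Real.one_lt_rpow one_lt_two (by linarith)
  refine ⟨R₀ * (Real.log 2 ^ (β + 1))⁻¹ + R₁ * ((2 : ℝ) ^ q - 1)⁻¹ +
    R₂ * 2 ^ α * (Real.log 2 ^ β)⁻¹, fun T hT => ?_⟩
  have hT2 : (2 : ℝ) ≤ T := by exact_mod_cast hT
  have hT0 : (0 : ℝ) < T := by linarith
  set L := Real.log T with hL_def
  have hL : Real.log 2 ≤ L := Real.log_le_log two_pos hT2
  have hL0 : 0 < L := hl2.trans_le hL
  rw [hD]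
  have hq0 : 0 < q := by linarith
  have hqα0 : 0 < q + α := by linarith
  -- The real number z solves 2^{(q+α)z} = T, so that 2^{qz} and T 2^{-αz} are both equal to G.
  -- Rounding z down to K costs a factor of at most 2^α in the second term.
  set z : ℝ := L / ((q + α) * Real.log 2) with hz
  have hz0 : 0 ≤ z := by positivity
  have hzL : z * Real.log 2 = L / (q + α) := by rw [hz]; field_simp
  refine ⟨⌊z⌋₊, ?_⟩
  have hTT : (T : ℝ) * (T : ℝ) ^ (-(α / (q + α))) = Real.exp (L * (q / (q + α))) := by
    rw [Real.rpow_def_of_pos hT0]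
    nth_rw 1 [← Real.exp_log hT0]
    rw [← hL_def, ← Real.exp_add]
    congr 1
    field_simp
    ring
  set G := (T : ℝ) * (T : ℝ) ^ (-(α / (q + α))) with hG
  have hG1 : 1 ≤ G := by rw [hTT]; exact Real.one_le_exp (by positivity)
  have hgeom : ∑ k ∈ Finset.range ⌊z⌋₊, ((2 : ℝ) ^ q) ^ k ≤ ((2 : ℝ) ^ q - 1)⁻¹ * G := by
    rw [geom_sum_eq h2q.ne', div_eq_inv_mul]
    have hpos : 0 ≤ ((2 : ℝ) ^ q - 1)⁻¹ := inv_nonneg.2 (by linarith)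
    refine mul_le_mul_of_nonneg_left ?_ hpos
    have : ((2 : ℝ) ^ q) ^ ⌊z⌋₊ ≤ G := by
      rw [hTT, ← Real.rpow_natCast, ← Real.rpow_mul two_pos.le, Real.rpow_def_of_pos two_pos]
      refine Real.exp_le_exp.2 ?_
      calc Real.log 2 * (q * ⌊z⌋₊) ≤ Real.log 2 * (q * z) := by
            gcongr
            exact Nat.floor_le hz0
        _ = q * (z * Real.log 2) := by ring
        _ = L * (q / (q + α)) := by rw [hzL]; ring
    linarith
  have hrate : T * rate α ⌊z⌋₊ ≤ 2 ^ α * G := by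
    have : rate α ⌊z⌋₊ ≤ 2 ^ α * (T : ℝ) ^ (-(α / (q + α))) := by
      rw [rate, Real.rpow_def_of_pos two_pos, Real.rpow_def_of_pos two_pos,
        Real.rpow_def_of_pos hT0, ← Real.exp_add]
      refine Real.exp_le_exp.2 ?_
      have h1 : z ≤ ⌊z⌋₊ + 1 := (Nat.lt_floor_add_one z).le
      have h2 : Real.log 2 * α * z ≤ Real.log 2 * α * (⌊z⌋₊ + 1) := by gcongr
      have h3 : Real.log 2 * α * z = L * (α / (q + α)) := by
        calc Real.log 2 * α * z = α * (z * Real.log 2) := by ring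
          _ = _ := by rw [hzL]; ring
      rw [← hL_def]
      linarith
    calc T * rate α ⌊z⌋₊ ≤ T * (2 ^ α * (T : ℝ) ^ (-(α / (q + α)))) := by gcongr
      _ = 2 ^ α * G := by rw [hG]; ring
  have e0 : 1 ≤ (Real.log 2 ^ (β + 1))⁻¹ * L ^ (β + 1) := by
    rw [inv_mul_eq_div, one_le_div (by positivity)]
    exact Real.rpow_le_rpow hl2.le hL (by linarith)
  have e1 : 1 ≤ (Real.log 2 ^ β)⁻¹ * L ^ β := by
    rw [inv_mul_eq_div, one_le_div (by positivity)]
    exact Real.rpow_le_rpow hl2.le hL hβ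
  have e2 : L ^ (β + 1) = L ^ β * L := Real.rpow_add_one hL0.ne' β
  have t0 : R₀ ≤ R₀ * ((Real.log 2 ^ (β + 1))⁻¹ * L ^ (β + 1)) * G :=
    calc R₀ = R₀ * 1 * 1 := by ring
      _ ≤ _ := by gcongr
  have t1 : R₁ * L ^ (β + 1) * ∑ k ∈ Finset.range ⌊z⌋₊, ((2 : ℝ) ^ q) ^ k ≤
      R₁ * L ^ (β + 1) * (((2 : ℝ) ^ q - 1)⁻¹ * G) := by gcongr
  have t2 : T * (R₂ * L * rate α ⌊z⌋₊) ≤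
      R₂ * L * ((Real.log 2 ^ β)⁻¹ * L ^ β) * (2 ^ α * G) :=
    calc T * (R₂ * L * rate α ⌊z⌋₊) = R₂ * L * 1 * (T * rate α ⌊z⌋₊) := by ring
      _ ≤ _ := by
        refine mul_le_mul (by gcongr) hrate ?_ (by positivity)
        have := rate_pos α ⌊z⌋₊
        positivity
  refine (add_le_add (add_le_add t0 t1) t2).trans (le_of_eq ?_)
  calc _ = (R₀ * (Real.log 2 ^ (β + 1))⁻¹ + R₁ * ((2 : ℝ) ^ q - 1)⁻¹) * G * L ^ (β + 1) +
        R₂ * 2 ^ α * (Real.log 2 ^ β)⁻¹ * G * (L ^ β * L) := by ring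
    _ = _ := by rw [← e2, hG]; ring

end Assembly

end AdaptiveBandit

/-! ### Proof of the theorem -/

open AdaptiveBandit in
theorem theorem2 (d m : ℕ) (hd : 0 < d) (α β A M M' C₀ a₀ μ : ℝ)
    (hα0 : 0 ≤ α) (hα2 : α ≤ 2) (hβ : 0 ≤ β) (hA : 0 < A) (ha₀ : 0 < a₀)
    (hμ : (1 + (2 : ℝ) ^ ((d : ℝ) + α)) * M < μ) :
    ∃ C : ℝ, ∀ (S : Set (Fin d → ℝ)) (c : Fin m → Fin d → ℝ)
      (f : (Fin d → ℝ) → ℝ) (xs : Fin d → ℝ),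
      AdaptiveBandit.CostAssumption S A M C₀ α β f xs →
      AdaptiveBandit.InitialBins S A a₀ c →
      (∀ j : Fin m, ∀ x ∈ AdaptiveBandit.Bin.region a₀ c ((j, []) : AdaptiveBandit.Bin d m),
        f x - f xs ≤ M') →
      ∀ (Ω : Type*) [mΩ : MeasurableSpace Ω] (P : Measure Ω) [IsProbabilityMeasure P]
        (ℱ : Filtration ℕ mΩ) (b : ℕ → Ω → AdaptiveBandit.Bin d m)
        (U X : ℕ → Ω → Fin d → ℝ) (W Y : ℕ → Ω → ℝ),
        AdaptiveBandit.IsRun α a₀ μ c f P ℱ b U X W Y →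
        ∀ T : ℕ, 2 ≤ T →
          Integrable (fun ω => AdaptiveBandit.cumRegret f xs (fun t => X t ω) T) P ∧
          (∫ ω, AdaptiveBandit.cumRegret f xs (fun t => X t ω) T ∂P) / (T : ℝ) ≤
            C * (T : ℝ) ^ (-(α / ((d : ℝ) + 2 * α - α * β))) * Real.log T ^ (β + 1) := by
  have hl2 : 0 < Real.log 2 := Real.log_pos one_lt_two
  by_cases hαβ : α * β ≤ d
  swap
  -- No cost function satisfies the assumptions for such exponents, so any constant works.
  · exact ⟨0, fun S c f xs hS => absurd (hS.mul_le hA hd) hαβ⟩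
  rcases hα0.eq_or_lt with rfl | hα
  -- For α = 0 the power of T is 1 and the trivial bound T M' on the regret suffices. The geometric
  -- ratio 2^{d+α-αβ} would be 1 here if d were 0, and the balancing argument is only set up for α >
  -- 0.
  · refine ⟨|M'| * (Real.log 2 ^ (β + 1))⁻¹,
      fun S c f xs hS hc hM' Ω mΩ P _ ℱ b U X W Y h T hT => ?_⟩
    have hf := gapBounds_of_initialBins ha₀ hS hc hM'
    refine ⟨h.integrable_cumRegret hf T, ?_⟩
    have hT2 : (2 : ℝ) ≤ T := by exact_mod_cast hT
    have hT0 : (0 : ℝ) < T := by linarith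
    have hR : ∫ ω, cumRegret f xs (fun t => X t ω) T ∂P ≤ T * M' := by
      rw [h.integral_cumRegret_eq hf, integral_finsetSum _ fun t _ => h.integrable_gap_pick hf t]
      refine (Finset.sum_le_card_nsmul _ _ M' fun t _ => ?_).trans (by simp)
      refine (integral_mono (h.integrable_gap_pick hf t) (integrable_const M')
        fun ω => hf.gap_le _).trans (by simp)
    have e0 : 1 ≤ (Real.log 2 ^ (β + 1))⁻¹ * Real.log T ^ (β + 1) := by
      rw [inv_mul_eq_div, one_le_div (by positivity)]
      exact Real.rpow_le_rpow hl2.le (Real.log_le_log two_pos hT2) (by linarith)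
    rw [div_le_iff₀ hT0, zero_div, neg_zero, Real.rpow_zero]
    calc _ ≤ T * M' := hR
      _ ≤ T * (|M'| * 1) := by rw [mul_one]; gcongr; exact le_abs_self _
      _ ≤ T * (|M'| * ((Real.log 2 ^ (β + 1))⁻¹ * Real.log T ^ (β + 1))) := by gcongr
      _ = _ := by ring
  by_cases hC₀ : 0 < C₀
  swap
  · exact ⟨0, fun S c f xs hS => absurd (hS.constant_pos hA) hC₀⟩
  obtain ⟨C₁, hC₁, hsplit⟩ := exists_gap_le_of_split d m M' hα0 hA ha₀ hμ
  set Z : ℝ := ∑' s : ℕ, 1 / (s : ℝ) ^ 2 with hZ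
  have hZ0 : 0 ≤ Z := tsum_nonneg fun s => by positivity
  obtain ⟨C, hC⟩ := exists_horizon_bound hα hβ hαβ
    (2 * m * |M'| + 2 ^ d * |M'| * (36 * Real.exp (50 * varProxy M') * Z))
    (m * (2 ^ d + 1) * C₀ * (18 * 4 ^ d) * C₁ *
        ((Real.log 2 ^ β)⁻¹ + (2 * C₁) ^ β / a₀ ^ d))
    (2 ^ d * C₁) (by positivity) (by positivity) (by positivity)
  refine ⟨C, fun S c f xs hS hc hM' Ω mΩ P _ ℱ b U X W Y h T hT => ?_⟩
  have hf := gapBounds_of_initialBins ha₀ hS hc hM'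
  refine ⟨h.integrable_cumRegret hf T, ?_⟩
  have hT2 : (2 : ℝ) ≤ T := by exact_mod_cast hT
  have hT0 : (0 : ℝ) < T := by linarith
  have hL : Real.log 2 ≤ Real.log T := Real.log_le_log two_pos hT2
  obtain ⟨K, hK⟩ := hC T hT
  rw [div_le_iff₀' hT0]
  refine le_trans ?_ hK
  have hE : 0 < C₁ * Real.log T := mul_pos hC₁ (hl2.trans_le hL)
  refine (h.integral_cumRegret_le hα0 hα2 hS hA hc hf hE T K
    fun ω t ht hsp hdev => hsplit hS hc hf h T t ω hT ht hsp hdev).trans ?_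
  have hsum := Finset.sum_le_sum fun k (_ : k ∈ Finset.range K) =>
    level_term_le d m hβ hαβ hC₀ ha₀ hC₁ hL k
  rw [← Finset.mul_sum] at hsum
  have hexp := Real.exp_pos (50 * varProxy M')
  have h1 : 2 * (m : ℝ) * M' ≤ 2 * m * |M'| := by gcongr; exact le_abs_self _
  have h2 : 2 ^ d * M' * (36 * Real.exp (50 * varProxy M') * Z) ≤
      2 ^ d * |M'| * (36 * Real.exp (50 * varProxy M') * Z) := by
    gcongr
    exact le_abs_self _
  have h3 : (T : ℝ) * (2 ^ d * (C₁ * Real.log T * rate α K)) =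
      T * (2 ^ d * C₁ * Real.log T * rate α K) := by ring
  rw [h3]
  linarith
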